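/- Let $\lambda_1\neq\lambda_2$ be complex numbers with $\operatorname{Im}\lambda_1>0$, $\operatorname{Im}\lambda_2>0$, labelled so that $\operatorname{Re}\lambda_1\le\operatorname{Re}\lambda_2$, and let $\Sigma$ be the elliptic curve $$\mu^2=(\lambda-\lambda_1)(\lambda-\bar\lambda_1)(\lambda-\lambda_2)(\lambda-\bar\lambda_2),$$ which is the spectral curve of the genus-one finite-gap solutions of the focusing nonlinear Schrödinger and vortex filament equations. Let $\infty_\pm$ be its points at infinity, with $\mu/\lambda^2\to\pm1$ at $\infty_\pm$, and let the upper (lower) sheet of $\Sigma$ be the one, relative to the vertical branch cuts from $\bar\lambda_j$ to $\lambda_j$, that contains $\infty_+$ ($\infty_-$). Let $a$ be the cycle on $\Sigma$ that goes from $\bar\lambda_1$ to $\lambda_1$ along the left-hand side of the branch cuts on the upper sheet, and back along the same path on the lower sheet. Let $\omega$ be the holomorphic differential on $\Sigma$ with $\oint_a\omega=2\pi i$, that is, $$\omega=2\pi i\left(\oint_a\frac{d\lambda}{\mu}\right)^{-1}\frac{d\lambda}{\mu},$$ and let $$r=\int_{\infty_-}^{\infty_+}\omega,\qquad \rho=\tfrac12\operatorname{Re}(r),$$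 where the path of integration comes from $\infty_-$ to $\bar\lambda_2$ along the ray $\{\bar\lambda_2+t: t>0\}$ on the lower sheet and goes back to $\infty_+$ along the same ray on the upper sheet. Put $$p'=\frac{|\lambda_1-\lambda_2|}{|\lambda_1-\bar\lambda_2|},\qquad p=\sqrt{1-(p')^2},\qquad K=K(p)=\int_0^{\pi/2}\frac{d\theta}{\sqrt{1-p^2\sin^2\theta}},$$ and let $$w=\operatorname{dn}\!\left(\frac{2K\rho}{\pi},\,p'\right),$$ where $\operatorname{dn}(u,k)$ is the Jacobi elliptic function with modulus $k$, i.e. $\operatorname{dn}(u,k)=\sqrt{1-k^2\sin^2\varphi}$ with $u=\int_0^{\varphi}d\theta/\sqrt{1-k^2\sin^2\theta}$. Then $$w^2=\frac{|\operatorname{Im}(\lambda_1-\bar\lambda_2)|^2}{|\lambda_1-\bar\lambda_2|^2}.$$ -/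

import Mathlib

open Real MeasureTheory intervalIntegral ComplexConjugate

noncomputable section

/-! ### Elliptic integrals and the Jacobi function dn -/

/-- Legendre's incomplete elliptic integral of the first kind, with amplitude `φ` and modulus `k`. -/
def ellipticF (φ k : ℝ) : ℝ :=
  ∫ θ in (0 : ℝ)..φ, 1 / √(1 - k ^ 2 * Real.sin θ ^ 2)

/-- The complete elliptic integral of the first kind with modulus `k`. -/
def ellipticK (k : ℝ) : ℝ := ellipticF (π / 2) k

theorem ellipticF_radicand_pos {k : ℝ} (h₀ : 0 ≤ k) (h₁ : k < 1) (θ : ℝ) :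
    0 < 1 - k ^ 2 * Real.sin θ ^ 2 := by
  have hs : Real.sin θ ^ 2 ≤ 1 := Real.sin_sq_le_one θ
  have hk : k ^ 2 < 1 := by nlinarith
  nlinarith [sq_nonneg k, sq_nonneg (Real.sin θ)]

theorem ellipticF_integrand_continuous {k : ℝ} (h₀ : 0 ≤ k) (h₁ : k < 1) :
    Continuous fun θ : ℝ => 1 / √(1 - k ^ 2 * Real.sin θ ^ 2) := by
  refine Continuous.div continuous_const (by fun_prop) fun θ => ?_
  exact (Real.sqrt_pos.2 (ellipticF_radicand_pos h₀ h₁ θ)).ne'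

theorem ellipticF_integrand_one_le {k : ℝ} (h₀ : 0 ≤ k) (h₁ : k < 1) (θ : ℝ) :
    1 ≤ 1 / √(1 - k ^ 2 * Real.sin θ ^ 2) := by
  rw [le_div_iff₀ (Real.sqrt_pos.2 (ellipticF_radicand_pos h₀ h₁ θ)), one_mul]
  refine Real.sqrt_le_iff.2 ⟨zero_le_one, ?_⟩
  nlinarith [mul_nonneg (sq_nonneg k) (sq_nonneg (Real.sin θ))]

theorem ellipticF_sub_le {k : ℝ} (h₀ : 0 ≤ k) (h₁ : k < 1) {a b : ℝ} (hab : a ≤ b) :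
    b - a ≤ ellipticF b k - ellipticF a k := by
  have hc := ellipticF_integrand_continuous h₀ h₁
  unfold ellipticF
  rw [intervalIntegral.integral_interval_sub_left (hc.intervalIntegrable _ _)
    (hc.intervalIntegrable _ _)]
  calc b - a = ∫ _ in a..b, (1 : ℝ) := by simp
    _ ≤ _ := intervalIntegral.integral_mono_on hab (by simp) (hc.intervalIntegrable _ _)
        fun θ _ => ellipticF_integrand_one_le h₀ h₁ θ

/-- For `0 ≤ k < 1` the map `φ ↦ F(φ, k)` is a bijection of the real line, so that the amplitude
below is its genuine two-sided inverse. -/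
theorem ellipticF_bijective {k : ℝ} (h₀ : 0 ≤ k) (h₁ : k < 1) :
    Function.Bijective fun φ => ellipticF φ k := by
  have hz : ellipticF 0 k = 0 := by simp [ellipticF]
  constructor
  · refine StrictMono.injective fun a b hab => ?_
    have := ellipticF_sub_le h₀ h₁ hab.le
    show ellipticF a k < ellipticF b k
    linarith
  · have hcont : Continuous fun φ => ellipticF φ k :=
      intervalIntegral.continuous_primitive
        (fun a b => (ellipticF_integrand_continuous h₀ h₁).intervalIntegrable a b) 0
    refine hcont.surjective ?_ ?_
    · refine Filter.tendsto_atTop_mono' _ ?_ Filter.tendsto_id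
      filter_upwards [Filter.eventually_ge_atTop (0 : ℝ)] with x hx
      have := ellipticF_sub_le h₀ h₁ hx
      simp only [id]
      linarith
    · refine Filter.tendsto_atBot_mono' _ ?_ Filter.tendsto_id
      filter_upwards [Filter.eventually_le_atBot (0 : ℝ)] with x hx
      have := ellipticF_sub_le h₀ h₁ hx
      simp only [id]
      linarith

/-- The Jacobi amplitude `am(u, k)`: the `φ` with `F(φ, k) = u`. -/
def jacobiAm (u k : ℝ) : ℝ := Function.invFun (fun φ => ellipticF φ k) u

/-- The Jacobi elliptic function `dn(u, k)` of real argument `u` and modulus `0 ≤ k < 1`. -/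
def jacobiDn (u k : ℝ) : ℝ := √(1 - k ^ 2 * Real.sin (jacobiAm u k) ^ 2)

/-! ### The elliptic curve `μ² = (λ - λ₁)(λ - λ̄₁)(λ - λ₂)(λ - λ̄₂)`

The branch points satisfy `Im λ₁, Im λ₂ > 0` and `Re λ₁ ≤ Re λ₂`. The branch cuts are the vertical
segments joining `λ̄ⱼ` to `λⱼ`. -/

/-- The branch of `√((z - l)(z - l̄))` that is holomorphic off the vertical segment from `l̄` to `l`
and asymptotic to `z` at infinity. -/
def cutSqrt (l z : ℂ) : ℂ :=
  (z - (l.re : ℂ)) * (1 + (l.im : ℂ) ^ 2 / (z - (l.re : ℂ)) ^ 2) ^ (1 / 2 : ℂ)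

/-- The value of `μ` on the upper sheet, the one containing `∞₊` (where `μ / λ² → 1`). On the lower
sheet, which contains `∞₋`, the value is the opposite one. It is used only at points lying
to the left, or only at points lying to the right, of both vertical lines `Re λ = Re λⱼ`. -/
def upperMu (l₁ l₂ z : ℂ) : ℂ := cutSqrt l₁ z * cutSqrt l₂ z

theorem cutSqrt_sq {l z : ℂ} (h : z.re ≠ l.re) :
    cutSqrt l z ^ 2 = (z - l) * (z - conj l) := by
  have hz : z - (l.re : ℂ) ≠ 0 := by
    intro h0
    apply h
    have := congrArg Complex.re h0
    simp at this
    linarith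
  have hl : (z - l) * (z - conj l) = (z - (l.re : ℂ)) ^ 2 + (l.im : ℂ) ^ 2 := by
    apply Complex.ext <;> simp [pow_two] <;> ring
  have hs : ∀ x : ℂ, (x ^ (1 / 2 : ℂ)) ^ 2 = x := by
    intro x
    rw [← Complex.cpow_nat_mul]
    simp
  rw [cutSqrt, mul_pow, hs, hl]
  field_simp

/-- The points `(z, ± upperMu l₁ l₂ z)` lie on the elliptic curve. -/
theorem upperMu_sq {l₁ l₂ z : ℂ} (h₁ : z.re ≠ l₁.re) (h₂ : z.re ≠ l₂.re) :
    upperMu l₁ l₂ z ^ 2 = (z - l₁) * (z - conj l₁) * ((z - l₂) * (z - conj l₂)) := by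
  rw [upperMu, mul_pow, cutSqrt_sq h₁, cutSqrt_sq h₂]

/-- The half circle that leads from `λ̄₁` (at `θ = -π/2`) to `λ₁` (at `θ = π/2`) along the left-hand
side of the branch cut between them. -/
def leftArc (l₁ : ℂ) (θ : ℝ) : ℂ :=
  (l₁.re : ℂ) - (l₁.im : ℂ) * Complex.exp (-(Complex.I * θ))

/-- The period `∮_a dλ/μ`. The cycle `a` goes around the left branch cut: from `λ̄₁` to `λ₁`
along its left-hand side on the upper sheet, and back along the same arc on the lower sheet. -/
def aPeriod (l₁ l₂ : ℂ) : ℂ :=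
  (∫ θ in (-(π / 2))..(π / 2), deriv (leftArc l₁) θ / upperMu l₁ l₂ (leftArc l₁ θ)) +
    ∫ θ in (π / 2)..(-(π / 2)), deriv (leftArc l₁) θ / (-upperMu l₁ l₂ (leftArc l₁ θ))

/-- `shiftR l₁ l₂ = ∫_{∞₋}^{∞₊} ω`, where `ω = (2πi / ∮_a dλ/μ) dλ/μ` is the holomorphic
differential with `a`-period `2πi`. The path of integration goes from `∞₋` to the rightmost branch
point `λ̄₂` in the lower half-plane along the ray `λ̄₂ + t`, `t > 0`, on the lower sheet, and then
along the same ray to `∞₊` on the upper sheet. -/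
def shiftR (l₁ l₂ : ℂ) : ℂ :=
  (2 * π * Complex.I / aPeriod l₁ l₂) *
    (-(∫ t in Set.Ioi (0 : ℝ), 1 / (-upperMu l₁ l₂ (conj l₂ + t))) +
      ∫ t in Set.Ioi (0 : ℝ), 1 / upperMu l₁ l₂ (conj l₂ + t))

/-- `ρ = Re(r) / 2`. -/
def rhoParam (l₁ l₂ : ℂ) : ℝ := (shiftR l₁ l₂).re / 2

/-- The complementary modulus `p' = |λ₁ - λ₂| / |λ₁ - λ̄₂|`. -/
def modulus' (l₁ l₂ : ℂ) : ℝ := ‖l₁ - l₂‖ / ‖l₁ - conj l₂‖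

/-- The modulus `p = √(1 - p'²)`. -/
def modulus (l₁ l₂ : ℂ) : ℝ := √(1 - modulus' l₁ l₂ ^ 2)

/-- `w = dn(2Kρ/π, p')`, where `K = K(p)`. -/
def wParam (l₁ l₂ : ℂ) : ℝ :=
  jacobiDn (2 * ellipticK (modulus l₁ l₂) * rhoParam l₁ l₂ / π) (modulus' l₁ l₂)

end

/-! Write `D = ‖l₁ - conj l₂‖`, `E = ‖l₁ - l₂‖`, `bⱼ = Im lⱼ` and let `cⱼ` be the factor `cutSqrt
lⱼ` of `μ`. Real and imaginary parts of `∫ dλ/μ` are integrals at the sum and the difference of a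
curve point and its conjugate. By the addition theorem both are Legendre integrals `F(φ, k)`, where
`φ` is the polar angle of an explicit plane curve; this is checked by differentiation.

Imaginary part: the angle of `(Re (c₁ c̄₂), D Im λ)` has `dF(φ, p) = D Im (dλ/μ)`
(`hasDerivAt_ellipticF_modulus`). It grows from `0` to `π/2` on the upper half of the left arc, so
`∮_a dλ/μ = 4iK(p)/D` (`aPeriod_eq`).

Real part: on the ray, `(rayCn, raySn)` moves on the circle of radius `E`, and its angle has `dF(φ,
p') = D Re (dλ/μ)` (`hasDerivAt_ellipticF_modulus'`). The angle starts at `0`, and `rayCn` tends to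
`b₂ - b₁`, whence `cn(D Re J, p') = (b₂ - b₁)/E` for the ray integral `J` (`cos_jacobiAm_ray`).

The normalisation gives `r = (πD/K) J`, so `2Kρ/π = D Re J`. As `D² - E² = 4b₁b₂`, it follows that
`dn² = 1 - (E²/D²)(1 - cn²) = (b₁ + b₂)²/D²`. -/

/-! ### Calculus of Legendre's integral -/

theorem hasDerivAt_ellipticF {k : ℝ} (h₀ : 0 ≤ k) (h₁ : k < 1) (φ : ℝ) :
    HasDerivAt (fun φ => ellipticF φ k) (1 / √(1 - k ^ 2 * Real.sin φ ^ 2)) φ := by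
  have hc := ellipticF_integrand_continuous h₀ h₁
  exact intervalIntegral.integral_hasDerivAt_right (hc.intervalIntegrable _ _)
    hc.stronglyMeasurable.stronglyMeasurableAtFilter hc.continuousAt

theorem ellipticF_zero (k : ℝ) : ellipticF 0 k = 0 := by simp [ellipticF]

theorem ellipticF_jacobiAm {k : ℝ} (h₀ : 0 ≤ k) (h₁ : k < 1) (u : ℝ) :
    ellipticF (jacobiAm u k) k = u :=
  Function.invFun_eq ((ellipticF_bijective h₀ h₁).2 u)

/-- The integrand is at least `1`, so `F` expands distances. A limit of `F(φ)` therefore yields a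
limit of `φ` with no appeal to continuity of the amplitude. -/
theorem abs_sub_le_abs_ellipticF_sub {k : ℝ} (h₀ : 0 ≤ k) (h₁ : k < 1) (a b : ℝ) :
    |b - a| ≤ |ellipticF b k - ellipticF a k| := by
  rcases le_total a b with h | h
  · have := ellipticF_sub_le h₀ h₁ h
    rw [abs_of_nonneg (by linarith), abs_of_nonneg (by linarith)]
    exact this
  · have := ellipticF_sub_le h₀ h₁ h
    rw [abs_of_nonpos (by linarith), abs_of_nonpos (by linarith)]
    linarith

theorem ellipticK_pos {k : ℝ} (h₀ : 0 ≤ k) (h₁ : k < 1) : 0 < ellipticK k := by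
  have := ellipticF_sub_le h₀ h₁ (a := 0) (b := π / 2) (by positivity)
  rw [ellipticF_zero] at this
  have := Real.pi_pos
  unfold ellipticK
  linarith

/-- The derivative of `F(φ, k)` along a plane curve with polar angle `φ`. -/
theorem hasDerivAt_ellipticF_arg {k : ℝ} (h₀ : 0 ≤ k) (h₁ : k < 1) {f g : ℝ → ℝ} {f' g' t : ℝ}
    (hf : HasDerivAt f f' t) (hg : HasDerivAt g g' t)
    (hs : (⟨f t, g t⟩ : ℂ) ∈ Complex.slitPlane) :
    HasDerivAt (fun t => ellipticF (Complex.arg ⟨f t, g t⟩) k)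
      ((f t * g' - g t * f') / (f t ^ 2 + g t ^ 2) /
        √(1 - k ^ 2 * (g t ^ 2 / (f t ^ 2 + g t ^ 2)))) t := by
  have hF : HasDerivAt (fun t => (⟨f t, g t⟩ : ℂ)) ⟨f', g'⟩ t := by
    have h := (hf.ofReal_comp).add ((hg.ofReal_comp).mul_const Complex.I)
    have e : ∀ x y : ℝ, (x : ℂ) + y * Complex.I = ⟨x, y⟩ := fun x y =>
      (Complex.mk_eq_add_mul_I x y).symm
    rw [e] at h
    refine h.congr_of_eventuallyEq (Filter.Eventually.of_forall fun s => ?_)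
    exact (e _ _).symm
  have hlog := Complex.imCLM.hasFDerivAt.comp_hasDerivAt t (hF.clog_real hs)
  have h := (hasDerivAt_ellipticF h₀ h₁ (Complex.arg ⟨f t, g t⟩)).comp t
    (h := fun t => Complex.arg ⟨f t, g t⟩) (h' := (f t * g' - g t * f') / (f t ^ 2 + g t ^ 2)) (by
      have h2 : HasDerivAt (fun t => Complex.arg ⟨f t, g t⟩) _ t :=
        hlog.congr_of_eventuallyEq (Filter.Eventually.of_forall fun s => (Complex.log_im _).symm)
      refine h2.congr_deriv ?_
      simp only [Complex.imCLM_apply, Complex.div_im, Complex.normSq_mk]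
      ring)
  refine h.congr_deriv ?_
  have hn : ‖(⟨f t, g t⟩ : ℂ)‖ ^ 2 = f t ^ 2 + g t ^ 2 := by
    rw [← Complex.normSq_eq_norm_sq, Complex.normSq_mk]; ring
  rw [Complex.sin_arg, div_pow, hn]
  ring

/-! ### The square roots `cutSqrt` -/

/-- `b²/w²` is a nonnegative multiple of `(conj w)²`, which for `Re w ≠ 0` is real only when `w` is
real, and then it is positive. Hence the principal power in `cutSqrt` is holomorphic off the line
`Re z = Re l`. -/
theorem one_add_div_sq_mem_slitPlane {w : ℂ} (hw : w.re ≠ 0) (b : ℝ) :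
    1 + (b : ℂ) ^ 2 / w ^ 2 ∈ Complex.slitPlane := by
  have hn : 0 < Complex.normSq w := Complex.normSq_pos.2 fun h => hw (by simp [h])
  have e : (b : ℂ) ^ 2 / w ^ 2 =
      ((b ^ 2 / Complex.normSq w ^ 2 : ℝ) : ℂ) * (conj w) ^ 2 := by
    have h0 : w ≠ 0 := fun h => hw (by simp [h])
    have h1 : ((Complex.normSq w : ℝ) : ℂ) = w * conj w := (Complex.mul_conj w).symm
    have h2 : conj w ≠ 0 := by simpa using h0
    push_cast
    rw [h1]
    field_simp
  rw [e, Complex.mem_slitPlane_iff]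
  by_cases h : w.im = 0
  · left
    have hw' : 0 ≤ b ^ 2 / Complex.normSq w ^ 2 * w.re ^ 2 := by positivity
    rw [Complex.add_re, Complex.re_ofReal_mul]
    simp only [Complex.one_re, pow_two (conj w), Complex.mul_re, Complex.conj_re, Complex.conj_im,
      h]
    nlinarith
  · by_cases hb : b = 0
    · left; simp [hb]
    right
    have : (b ^ 2 / Complex.normSq w ^ 2) ≠ 0 := by positivity
    rw [Complex.add_im, Complex.im_ofReal_mul]
    simp only [Complex.one_im, zero_add, pow_two (conj w), Complex.mul_im, Complex.conj_re,
      Complex.conj_im]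
    refine mul_ne_zero this ?_
    have : w.re * -w.im + -w.im * w.re = -2 * (w.re * w.im) := by ring
    rw [this]
    exact mul_ne_zero (by norm_num) (mul_ne_zero hw h)

theorem cutSqrt_sq_eq {l z : ℂ} (h : z.re ≠ l.re) :
    cutSqrt l z ^ 2 = (z - (l.re : ℂ)) ^ 2 + (l.im : ℂ) ^ 2 := by
  rw [cutSqrt_sq h]
  apply Complex.ext <;> simp [pow_two] <;> ring

theorem cutSqrt_ne_zero {l z : ℂ} (h : z.re ≠ l.re) : cutSqrt l z ≠ 0 := by
  intro h0
  have e := cutSqrt_sq h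
  rw [h0, zero_pow two_ne_zero, eq_comm, mul_eq_zero] at e
  rcases e with e | e <;> apply h <;> have := congrArg Complex.re e <;> simp at this <;> linarith

/-- The explicit branch is needed only for differentiability; the value follows by differentiating
`c² = (z - Re l)² + (Im l)²`. -/
theorem hasDerivAt_cutSqrt {l z : ℂ} (h : z.re ≠ l.re) :
    HasDerivAt (cutSqrt l) ((z - (l.re : ℂ)) / cutSqrt l z) z := by
  have hre : (z - (l.re : ℂ)).re ≠ 0 := by simpa [sub_eq_zero] using h
  have hz : z - (l.re : ℂ) ≠ 0 := fun e => hre (by simp [e])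
  have hd : DifferentiableAt ℂ (cutSqrt l) z := by
    have hs := one_add_div_sq_mem_slitPlane hre l.im
    unfold cutSqrt
    have hb : DifferentiableAt ℂ (fun z : ℂ => 1 + (l.im : ℂ) ^ 2 / (z - (l.re : ℂ)) ^ 2) z := by
      refine DifferentiableAt.const_add _ (DifferentiableAt.div (by fun_prop) (by fun_prop) ?_)
      exact pow_ne_zero _ hz
    exact DifferentiableAt.mul (by fun_prop) (hb.cpow (by fun_prop) hs)
  have h1 := hd.hasDerivAt.pow 2
  have h2 : HasDerivAt (fun z : ℂ => (z - (l.re : ℂ)) ^ 2 + (l.im : ℂ) ^ 2)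
      (2 * (z - (l.re : ℂ))) z := by
    simpa using (((hasDerivAt_id z).sub_const (l.re : ℂ)).pow 2).add_const ((l.im : ℂ) ^ 2)
  have h3 : (fun z : ℂ => (z - (l.re : ℂ)) ^ 2 + (l.im : ℂ) ^ 2) =ᶠ[nhds z] cutSqrt l ^ 2 := by
    have : ∀ᶠ w in nhds z, w.re ≠ l.re :=
      (Complex.continuous_re.continuousAt).eventually_ne h
    filter_upwards [this] with w hw
    simp [cutSqrt_sq_eq hw]
  have e := h1.unique (h2.congr_of_eventuallyEq h3.symm)
  refine hd.hasDerivAt.congr_deriv ?_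
  rw [eq_div_iff (cutSqrt_ne_zero h)]
  have e' : 2 * (deriv (cutSqrt l) z * cutSqrt l z) = 2 * (z - (l.re : ℂ)) := by
    rw [← e]; simp; ring
  exact mul_left_cancel₀ two_ne_zero e'

theorem cutSqrt_conj {l z : ℂ} (h : z.re ≠ l.re) : cutSqrt l (conj z) = conj (cutSqrt l z) := by
  have hre : (z - (l.re : ℂ)).re ≠ 0 := by simpa [sub_eq_zero] using h
  have hs := one_add_div_sq_mem_slitPlane hre l.im
  have e := Complex.conj_cpow (1 + (l.im : ℂ) ^ 2 / (z - (l.re : ℂ)) ^ 2) (1 / 2)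
    (Complex.slitPlane_arg_ne_pi hs)
  simp only [map_add, map_div₀, map_one, map_pow, map_sub, Complex.conj_ofReal, map_ofNat] at e
  simp only [cutSqrt, map_mul, map_sub, Complex.conj_ofReal, e]

/-- Fixes the sign of both square roots where the left arc crosses the real axis; their product is
positive there. -/
theorem cutSqrt_ofReal_neg {l : ℂ} {x : ℝ} (h : x < l.re) :
    ∃ c : ℝ, c < 0 ∧ cutSqrt l x = c := by
  have hx : (x - l.re) ^ 2 ≠ 0 := pow_ne_zero _ (by linarith)
  refine ⟨(x - l.re) * (1 + l.im ^ 2 / (x - l.re) ^ 2) ^ (1 / 2 : ℝ), ?_, ?_⟩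
  · exact mul_neg_of_neg_of_pos (by linarith) (by positivity)
  · rw [cutSqrt]
    push_cast
    rw [Complex.ofReal_cpow (by positivity)]
    push_cast
    rfl

theorem cutSqrt_re_sq_sub {l z : ℂ} (h : z.re ≠ l.re) :
    (cutSqrt l z).re ^ 2 - (cutSqrt l z).im ^ 2 = (z.re - l.re) ^ 2 - z.im ^ 2 + l.im ^ 2 := by
  have := congrArg Complex.re (cutSqrt_sq_eq h)
  simp [pow_two] at this
  linarith

theorem cutSqrt_re_mul_im {l z : ℂ} (h : z.re ≠ l.re) :
    (cutSqrt l z).re * (cutSqrt l z).im = (z.re - l.re) * z.im := by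
  have := congrArg Complex.im (cutSqrt_sq_eq h)
  simp [pow_two] at this
  linarith

theorem norm_cutSqrt_sq {l z : ℂ} (h : z.re ≠ l.re) :
    ‖cutSqrt l z‖ ^ 2 = ‖z - l‖ * ‖z - conj l‖ := by
  rw [← norm_pow, cutSqrt_sq h, norm_mul]

/-! ### The moduli -/

theorem norm_sub_sq_eq (l₁ l₂ : ℂ) :
    ‖l₁ - l₂‖ ^ 2 = (l₁.re - l₂.re) ^ 2 + (l₁.im - l₂.im) ^ 2 := by
  rw [← Complex.normSq_eq_norm_sq, Complex.normSq_apply]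
  simp; ring

theorem norm_sub_conj_sq (l₁ l₂ : ℂ) :
    ‖l₁ - conj l₂‖ ^ 2 = (l₁.re - l₂.re) ^ 2 + (l₁.im + l₂.im) ^ 2 := by
  rw [norm_sub_sq_eq]
  simp

theorem norm_sub_conj_pos {l₁ l₂ : ℂ} (him₁ : 0 < l₁.im) (him₂ : 0 < l₂.im) :
    0 < ‖l₁ - conj l₂‖ := by
  refine norm_pos_iff.2 fun h => ?_
  have := congrArg Complex.im h
  simp at this
  linarith

theorem modulus'_nonneg (l₁ l₂ : ℂ) : 0 ≤ modulus' l₁ l₂ := by unfold modulus'; positivity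

theorem modulus'_lt_one {l₁ l₂ : ℂ} (him₁ : 0 < l₁.im) (him₂ : 0 < l₂.im) :
    modulus' l₁ l₂ < 1 := by
  rw [modulus', div_lt_one (norm_sub_conj_pos him₁ him₂)]
  refine lt_of_pow_lt_pow_left₀ 2 (norm_nonneg _) ?_
  rw [norm_sub_sq_eq, norm_sub_conj_sq]
  nlinarith

theorem modulus_nonneg (l₁ l₂ : ℂ) : 0 ≤ modulus l₁ l₂ := Real.sqrt_nonneg _

theorem modulus_sq {l₁ l₂ : ℂ} (him₁ : 0 < l₁.im) (him₂ : 0 < l₂.im) :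
    modulus l₁ l₂ ^ 2 = 1 - ‖l₁ - l₂‖ ^ 2 / ‖l₁ - conj l₂‖ ^ 2 := by
  rw [modulus, Real.sq_sqrt, modulus', div_pow]
  have := modulus'_lt_one him₁ him₂
  nlinarith [modulus'_nonneg l₁ l₂]

theorem modulus_lt_one {l₁ l₂ : ℂ} (him₁ : 0 < l₁.im) (him₂ : 0 < l₂.im) (hne : l₁ ≠ l₂) :
    modulus l₁ l₂ < 1 := by
  refine lt_of_pow_lt_pow_left₀ 2 zero_le_one ?_
  rw [modulus_sq him₁ him₂]
  have h1 := norm_sub_conj_pos him₁ him₂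
  have h2 : 0 < ‖l₁ - l₂‖ := norm_pos_iff.2 (sub_ne_zero.2 hne)
  have : 0 < ‖l₁ - l₂‖ ^ 2 / ‖l₁ - conj l₂‖ ^ 2 := by positivity
  linarith

/-! ### The differential along a curve -/

/-- Since `μ = c₁c₂`, one has `dc₁ = (z - Re l₁) c₂ dz/μ`, and multiplying by `c̄₂` produces
`|c₂|²`. The real part of `c₁ c̄₂` serves the arc, the imaginary part the ray. -/
theorem hasDerivAt_cutSqrt_mul_conj {l₁ l₂ : ℂ} {γ : ℝ → ℂ} {v : ℂ} {t : ℝ}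
    (hγ : HasDerivAt γ v t) (h₁ : (γ t).re ≠ l₁.re) (h₂ : (γ t).re ≠ l₂.re) :
    HasDerivAt (fun s => cutSqrt l₁ (γ s) * conj (cutSqrt l₂ (γ s)))
      ((γ t - l₁.re) * (v / upperMu l₁ l₂ (γ t)) * (‖cutSqrt l₂ (γ t)‖ ^ 2 : ℝ) +
        conj ((γ t - l₂.re) * (v / upperMu l₁ l₂ (γ t))) * (‖cutSqrt l₁ (γ t)‖ ^ 2 : ℝ)) t := by
  have d₁ := (hasDerivAt_cutSqrt h₁).comp t hγ
  have d₂ := ((hasDerivAt_cutSqrt h₂).comp t hγ).star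
  refine (d₁.mul d₂).congr_deriv ?_
  have n₁ := cutSqrt_ne_zero h₁
  have n₂ := cutSqrt_ne_zero h₂
  have n₁' : conj (cutSqrt l₁ (γ t)) ≠ 0 := by simpa using n₁
  have n₂' : conj (cutSqrt l₂ (γ t)) ≠ 0 := by simpa using n₂
  have e : ∀ z : ℂ, ((‖z‖ ^ 2 : ℝ) : ℂ) = z * conj z := fun z => by
    rw [Complex.mul_conj, Complex.normSq_eq_norm_sq]
  simp only [e, Function.comp, upperMu, Complex.star_def, map_mul, map_div₀]
  field_simp

theorem norm_sq_eq_re_im (z : ℂ) : ‖z‖ ^ 2 = z.re ^ 2 + z.im ^ 2 := by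
  rw [← Complex.normSq_eq_norm_sq, Complex.normSq_apply]; ring

/-- The incomplete integral `F(·, p)`, along the real locus of the difference of a point of the
curve and its conjugate, has the imaginary part of the holomorphic differential as its
differential. -/
theorem hasDerivAt_ellipticF_modulus {l₁ l₂ : ℂ} (him₁ : 0 < l₁.im) (him₂ : 0 < l₂.im)
    (hne : l₁ ≠ l₂) {γ : ℝ → ℂ} {v : ℂ} {t : ℝ}
    (hγ : HasDerivAt γ v t) (h₁ : (γ t).re ≠ l₁.re) (h₂ : (γ t).re ≠ l₂.re)
    (hs : (⟨(cutSqrt l₁ (γ t) * conj (cutSqrt l₂ (γ t))).re, ‖l₁ - conj l₂‖ * (γ t).im⟩ : ℂ) ∈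
      Complex.slitPlane) :
    HasDerivAt (fun s => ellipticF (Complex.arg
        ⟨(cutSqrt l₁ (γ s) * conj (cutSqrt l₂ (γ s))).re, ‖l₁ - conj l₂‖ * (γ s).im⟩)
        (modulus l₁ l₂))
      (‖l₁ - conj l₂‖ * (v / upperMu l₁ l₂ (γ t)).im) t := by
  have d₁ := Complex.reCLM.hasFDerivAt.comp_hasDerivAt t (hasDerivAt_cutSqrt_mul_conj hγ h₁ h₂)
  have d₂ := (Complex.imCLM.hasFDerivAt.comp_hasDerivAt t hγ).const_mul ‖l₁ - conj l₂‖
  have key := hasDerivAt_ellipticF_arg (modulus_nonneg l₁ l₂) (modulus_lt_one him₁ him₂ hne)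
    (f := fun s => (cutSqrt l₁ (γ s) * conj (cutSqrt l₂ (γ s))).re)
    (g := fun s => ‖l₁ - conj l₂‖ * (γ s).im) d₁ d₂ hs
  refine key.congr_deriv ?_
  have hv : v = v / upperMu l₁ l₂ (γ t) * (cutSqrt l₁ (γ t) * cutSqrt l₂ (γ t)) := by
    rw [upperMu, div_mul_cancel₀]
    exact mul_ne_zero (cutSqrt_ne_zero h₁) (cutSqrt_ne_zero h₂)
  have hvi := congrArg Complex.im hv
  have r₁ := cutSqrt_re_sq_sub h₁
  have r₂ := cutSqrt_re_sq_sub h₂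
  have i₁ := cutSqrt_re_mul_im h₁
  have i₂ := cutSqrt_re_mul_im h₂
  have hD := norm_sub_conj_sq l₁ l₂
  have hE := norm_sub_sq_eq l₁ l₂
  have hD0 := norm_sub_conj_pos him₁ him₂
  have hp := modulus_sq him₁ him₂
  have n₁ := norm_sq_eq_re_im (cutSqrt l₁ (γ t))
  have n₂ := norm_sq_eq_re_im (cutSqrt l₂ (γ t))
  have p₁ : 0 < ‖cutSqrt l₁ (γ t)‖ ^ 2 := by
    have := norm_pos_iff.2 (cutSqrt_ne_zero h₁); positivity
  have p₂ : 0 < ‖cutSqrt l₂ (γ t)‖ ^ 2 := by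
    have := norm_pos_iff.2 (cutSqrt_ne_zero h₂); positivity
  simp only [Complex.reCLM_apply, Complex.imCLM_apply]
  generalize v / upperMu l₁ l₂ (γ t) = g at *
  generalize ‖l₁ - conj l₂‖ = D at *
  generalize ‖l₁ - l₂‖ = E at *
  generalize ‖cutSqrt l₁ (γ t)‖ ^ 2 = m₁ at *
  generalize ‖cutSqrt l₂ (γ t)‖ ^ 2 = m₂ at *
  generalize cutSqrt l₁ (γ t) = c₁ at *
  generalize cutSqrt l₂ (γ t) = c₂ at *
  generalize γ t = z at *
  simp only [Complex.mul_re, Complex.mul_im, Complex.add_re, Complex.conj_re, Complex.conj_im,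
    Complex.ofReal_re, Complex.ofReal_im, Complex.sub_re, Complex.sub_im] at *
  set B₁ := (z.re - l₁.re) ^ 2 + z.im ^ 2 + l₁.im ^ 2 with hB₁
  set B₂ := (z.re - l₂.re) ^ 2 + z.im ^ 2 + l₂.im ^ 2 with hB₂
  set ξ := c₁.re * c₂.re - c₁.im * -c₂.im with hξ
  -- `T` is the squared radius of the plane curve, and `Q / T` will be `√(1 - p² sin² φ)`.
  set Q := (m₁ * B₂ + m₂ * B₁) / 2 with hQ
  set T := ξ ^ 2 + (D * z.im) ^ 2 with hT
  have hQ0 : 0 < Q := by positivity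
  have s₁ : m₁ ^ 2 = B₁ ^ 2 - 4 * l₁.im ^ 2 * z.im ^ 2 := by
    have : m₁ ^ 2 = (c₁.re ^ 2 - c₁.im ^ 2) ^ 2 + 4 * (c₁.re * c₁.im) ^ 2 := by rw [n₁]; ring
    rw [this, r₁, i₁]; ring
  have s₂ : m₂ ^ 2 = B₂ ^ 2 - 4 * l₂.im ^ 2 * z.im ^ 2 := by
    have : m₂ ^ 2 = (c₂.re ^ 2 - c₂.im ^ 2) ^ 2 + 4 * (c₂.re * c₂.im) ^ 2 := by rw [n₂]; ring
    rw [this, r₂, i₂]; ring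
  have hξ2 : ξ ^ 2 = (m₁ * m₂ + B₁ * B₂) / 2 + 2 * l₁.im * l₂.im * z.im ^ 2 -
      D ^ 2 * z.im ^ 2 := by
    have : 2 * ξ ^ 2 = m₁ * m₂ + (c₁.re ^ 2 - c₁.im ^ 2) * (c₂.re ^ 2 - c₂.im ^ 2) +
        4 * (c₁.re * c₁.im) * (c₂.re * c₂.im) := by rw [hξ, n₁, n₂]; ring
    rw [r₁, r₂, i₁, i₂] at this
    rw [hD, hB₁, hB₂]
    linear_combination this / 2
  have hT' : T = (m₁ * m₂ + B₁ * B₂) / 2 + 2 * l₁.im * l₂.im * z.im ^ 2 := by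
    rw [hT, mul_pow, hξ2]; ring
  have hT0 : 0 < T := by
    rw [hT']; positivity
  have hGT : Q ^ 2 = (T - (D ^ 2 - E ^ 2) * z.im ^ 2) * T := by
    have : D ^ 2 - E ^ 2 = 4 * l₁.im * l₂.im := by rw [hD, hE]; ring
    rw [this, hT', hQ]
    linear_combination (B₂ ^ 2 / 4 - m₂ ^ 2 / 4) * s₁ + l₁.im ^ 2 * z.im ^ 2 * s₂
  have hrad : 1 - modulus l₁ l₂ ^ 2 * ((D * z.im) ^ 2 / T) = (Q / T) ^ 2 := by
    rw [hp, div_pow, hGT]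
    field_simp
  rw [hrad, Real.sqrt_sq (by positivity)]
  -- The angular numerator, up to the factor `D`. By `j₁` the coefficient of `g.re` cancels, so only
  -- `Im (dz/μ)` survives.
  have hnum : ξ * v.im - z.im * ((z.re - l₁.re) * m₂ * g.re - z.im * m₂ * g.im +
      (z.re - l₂.re) * m₁ * g.re - z.im * m₁ * g.im) = g.im * Q := by
    rw [hvi]
    have j₁ : (c₁.re * c₂.im + c₁.im * c₂.re) * ξ =
        z.im * ((z.re - l₁.re) * m₂ + (z.re - l₂.re) * m₁) := by
      rw [hξ, n₁, n₂]
      linear_combination (c₂.re ^ 2 + c₂.im ^ 2) * i₁ + (c₁.re ^ 2 + c₁.im ^ 2) * i₂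
    have j₂ : 2 * ((c₁.re * c₂.re - c₁.im * c₂.im) * ξ + z.im ^ 2 * (m₁ + m₂)) = 2 * Q := by
      rw [hξ, hQ, hB₁, hB₂, n₁, n₂]
      linear_combination (c₁.re ^ 2 + c₁.im ^ 2) * r₂ + (c₂.re ^ 2 + c₂.im ^ 2) * r₁
    linear_combination g.re * j₁ + g.im * j₂ / 2
  have : ∀ N : ℝ, N = D * (g.im * Q) → N / T / (Q / T) = D * g.im := by
    rintro _ rfl
    field_simp
  apply this
  rw [← hnum]
  ring

/-! ### Auxiliary facts on integrals -/

/-- The hypothesis says `‖g t‖ ≤ √(C/t)`, the inverse square-root singularity of `dλ/μ` at a branch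
point. -/
theorem intervalIntegrable_of_norm_sq_mul_le {g : ℝ → ℂ} {b C : ℝ} (hb : 0 ≤ b)
    (hg : ContinuousOn g (Set.Ioo 0 b)) (hC : ∀ t ∈ Set.Ioo 0 b, ‖g t‖ ^ 2 * t ≤ C) :
    IntervalIntegrable g volume 0 b := by
  have h := (intervalIntegrable_rpow' (a := 0) (b := b) (r := -(1 / 2)) (by norm_num)).const_mul √C
  rw [intervalIntegrable_iff_integrableOn_Ioo_of_le hb] at h ⊢
  refine Integrable.mono' h (hg.aestronglyMeasurable measurableSet_Ioo) ?_
  refine (ae_restrict_iff' measurableSet_Ioo).2 (Filter.Eventually.of_forall fun t ht => ?_)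
  rw [Real.rpow_neg ht.1.le, ← Real.sqrt_eq_rpow, ← div_eq_mul_inv, ← Real.sqrt_div' _ ht.1.le]
  refine Real.le_sqrt_of_sq_le ?_
  rw [le_div_iff₀ ht.1]
  exact hC t ht

theorem tendsto_complex_mk {α : Type*} {f : Filter α} {u v : α → ℝ} {a b : ℝ}
    (hu : Filter.Tendsto u f (nhds a)) (hv : Filter.Tendsto v f (nhds b)) :
    Filter.Tendsto (fun x => (⟨u x, v x⟩ : ℂ)) f (nhds ⟨a, b⟩) := by
  simp only [Complex.mk_eq_add_mul_I]
  exact ((Complex.continuous_ofReal.tendsto a).comp hu).add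
    (((Complex.continuous_ofReal.tendsto b).comp hv).mul_const _)

/-! ### The period along the left arc -/

theorem leftArc_eq (l : ℂ) (θ : ℝ) :
    leftArc l θ = ⟨l.re - l.im * Real.cos θ, l.im * Real.sin θ⟩ := by
  have : -(Complex.I * θ) = ((-θ : ℝ) : ℂ) * Complex.I := by push_cast; ring
  rw [leftArc, this, Complex.exp_mul_I, ← Complex.ofReal_cos, ← Complex.ofReal_sin]
  apply Complex.ext <;> simp [-Complex.ofReal_cos, -Complex.ofReal_sin]

theorem hasDerivAt_leftArc (l : ℂ) (θ : ℝ) :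
    HasDerivAt (leftArc l) (Complex.I * l.im * Complex.exp (-(Complex.I * θ))) θ := by
  have h : HasDerivAt (fun θ : ℝ => -(Complex.I * (θ : ℂ))) (-(Complex.I * 1)) θ :=
    ((Complex.ofRealCLM.hasDerivAt (x := θ)).const_mul Complex.I).neg
  refine ((h.cexp.const_mul (l.im : ℂ)).const_sub (l.re : ℂ)).congr_deriv ?_
  ring

theorem continuous_leftArc (l : ℂ) : Continuous (leftArc l) :=
  continuous_iff_continuousAt.2 fun θ => (hasDerivAt_leftArc l θ).continuousAt

theorem norm_deriv_leftArc (l : ℂ) (θ : ℝ) : ‖deriv (leftArc l) θ‖ = |l.im| := by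
  have : -(Complex.I * θ) = ((-θ : ℝ) : ℂ) * Complex.I := by push_cast; ring
  rw [(hasDerivAt_leftArc l θ).deriv, norm_mul, this, Complex.norm_exp_ofReal_mul_I]
  simp

theorem leftArc_neg (l : ℂ) (θ : ℝ) : leftArc l (-θ) = conj (leftArc l θ) := by
  rw [leftArc_eq, leftArc_eq]
  apply Complex.ext <;> simp

theorem deriv_leftArc_neg (l : ℂ) (θ : ℝ) :
    deriv (leftArc l) (-θ) = -conj (deriv (leftArc l) θ) := by
  rw [(hasDerivAt_leftArc l _).deriv, (hasDerivAt_leftArc l _).deriv]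
  simp [← Complex.exp_conj]

theorem leftArc_re_lt {l₁ : ℂ} (him₁ : 0 < l₁.im) {θ : ℝ}
    (h : θ ∈ Set.Ioo (-(π / 2)) (π / 2)) : (leftArc l₁ θ).re < l₁.re := by
  rw [leftArc_eq]
  have := mul_pos him₁ (Real.cos_pos_of_mem_Ioo h)
  simp only
  linarith

theorem norm_upperMu_sq {l₁ l₂ z : ℂ} (h₁ : z.re ≠ l₁.re) (h₂ : z.re ≠ l₂.re) :
    ‖upperMu l₁ l₂ z‖ ^ 2 = ‖z - l₁‖ * ‖z - conj l₁‖ * (‖z - l₂‖ * ‖z - conj l₂‖) := by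
  rw [upperMu, norm_mul, mul_pow, norm_cutSqrt_sq h₁, norm_cutSqrt_sq h₂]

theorem upperMu_ne_zero {l₁ l₂ z : ℂ} (h₁ : z.re ≠ l₁.re) (h₂ : z.re ≠ l₂.re) :
    upperMu l₁ l₂ z ≠ 0 :=
  mul_ne_zero (cutSqrt_ne_zero h₁) (cutSqrt_ne_zero h₂)

theorem continuousAt_upperMu {l₁ l₂ z : ℂ} (h₁ : z.re ≠ l₁.re) (h₂ : z.re ≠ l₂.re) :
    ContinuousAt (upperMu l₁ l₂) z :=
  (hasDerivAt_cutSqrt h₁).continuousAt.mul (hasDerivAt_cutSqrt h₂).continuousAt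

/-- The arc is a half circle on the diameter from `conj l₁` to `l₁`, with squared distances `2b₁²(1
∓ sin θ)` to its ends. The simple zero at `θ = π/2` makes the integrand integrable. -/
theorem norm_leftArc_sub_mul {l₁ : ℂ} (him₁ : 0 < l₁.im) {θ : ℝ}
    (h : θ ∈ Set.Ioo (-(π / 2)) (π / 2)) :
    ‖leftArc l₁ θ - l₁‖ * ‖leftArc l₁ θ - conj l₁‖ = 2 * l₁.im ^ 2 * Real.cos θ := by
  have hc := Real.cos_pos_of_mem_Ioo h
  refine (pow_left_inj₀ (by positivity) (by positivity) two_ne_zero).1 ?_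
  rw [mul_pow, norm_sub_sq_eq, norm_sub_conj_sq, leftArc_eq]
  have := Real.sin_sq_add_cos_sq θ
  have hs : Real.sin θ ^ 2 = 1 - Real.cos θ ^ 2 := by linarith
  simp only
  have e₁ : (l₁.re - l₁.im * Real.cos θ - l₁.re) ^ 2 + (l₁.im * Real.sin θ - l₁.im) ^ 2 =
      2 * l₁.im ^ 2 * (1 - Real.sin θ) := by linear_combination l₁.im ^ 2 * this
  have e₂ : (l₁.re - l₁.im * Real.cos θ - l₁.re) ^ 2 + (l₁.im * Real.sin θ + l₁.im) ^ 2 =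
      2 * l₁.im ^ 2 * (1 + Real.sin θ) := by linear_combination l₁.im ^ 2 * this
  rw [e₁, e₂]
  linear_combination -4 * l₁.im ^ 4 * this

theorem continuousOn_arc_integrand {l₁ l₂ : ℂ} (him₁ : 0 < l₁.im) (hre : l₁.re ≤ l₂.re) :
    ContinuousOn (fun θ => deriv (leftArc l₁) θ / upperMu l₁ l₂ (leftArc l₁ θ))
      (Set.Ioo (-(π / 2)) (π / 2)) := by
  intro θ hθ
  have h₁ := leftArc_re_lt him₁ hθ
  have h₂ := h₁.trans_le hre
  refine ContinuousAt.continuousWithinAt (ContinuousAt.div ?_ ?_ (upperMu_ne_zero h₁.ne h₂.ne))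
  · have : deriv (leftArc l₁) = fun θ : ℝ =>
        Complex.I * l₁.im * Complex.exp (-(Complex.I * θ)) :=
      funext fun θ => (hasDerivAt_leftArc l₁ θ).deriv
    rw [this]
    fun_prop
  · exact (continuousAt_upperMu h₁.ne h₂.ne).comp (continuous_leftArc l₁).continuousAt

theorem intervalIntegrable_arc_integrand {l₁ l₂ : ℂ} (him₁ : 0 < l₁.im) (him₂ : 0 < l₂.im)
    (hne : l₁ ≠ l₂) (hre : l₁.re ≤ l₂.re) :
    IntervalIntegrable (fun θ => deriv (leftArc l₁) θ / upperMu l₁ l₂ (leftArc l₁ θ)) volume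
      0 (π / 2) := by
  have hpi := Real.pi_pos
  have hcont : ContinuousOn (fun θ => ‖leftArc l₁ θ - l₂‖ * ‖leftArc l₁ θ - conj l₂‖)
      (Set.Icc 0 (π / 2)) := by
    have := continuous_leftArc l₁
    fun_prop
  obtain ⟨θ₀, hθ₀, hmin⟩ := isCompact_Icc.exists_isMinOn (Set.nonempty_Icc.2 (by positivity)) hcont
  set c := ‖leftArc l₁ θ₀ - l₂‖ * ‖leftArc l₁ θ₀ - conj l₂‖ with hcdef
  -- The arc lies strictly left of `Re l₁ ≤ Re l₂` except at its end `l₁ ≠ l₂`, and the quarter used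
  -- here never enters the lower half-plane, where `conj l₂` lies.
  have hc : 0 < c := by
    refine mul_pos (norm_pos_iff.2 fun h => ?_) (norm_pos_iff.2 fun h => ?_)
    · have h' := sub_eq_zero.1 h
      rcases hθ₀.2.eq_or_lt with e | e
      · apply hne
        rw [← h', leftArc_eq, e]
        apply Complex.ext <;> simp
      · have := leftArc_re_lt him₁ (θ := θ₀) ⟨by linarith [hθ₀.1], e⟩
        rw [h'] at this
        linarith
    · have h' := congrArg Complex.im (sub_eq_zero.1 h)
      have := Real.sin_nonneg_of_nonneg_of_le_pi hθ₀.1 (by linarith [hθ₀.2])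
      rw [leftArc_eq] at h'
      simp at h'
      nlinarith
  have main : IntervalIntegrable (fun s => deriv (leftArc l₁) (π / 2 - s) /
      upperMu l₁ l₂ (leftArc l₁ (π / 2 - s))) volume 0 (π / 2) := by
    refine intervalIntegrable_of_norm_sq_mul_le (C := π / (4 * c)) (by positivity)
      ((continuousOn_arc_integrand him₁ hre).comp (by fun_prop) fun s hs =>
        ⟨by linarith [hs.2], by linarith [hs.1]⟩) fun s hs => ?_
    have hmem : π / 2 - s ∈ Set.Ioo (-(π / 2)) (π / 2) := ⟨by linarith [hs.2], by linarith [hs.1]⟩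
    have h₁ := leftArc_re_lt him₁ hmem
    have h₂ := h₁.trans_le hre
    have hm := hmin (show π / 2 - s ∈ Set.Icc 0 (π / 2) from ⟨by linarith [hs.2], by linarith [hs.1]⟩)
    rw [norm_div, div_pow, norm_deriv_leftArc, norm_upperMu_sq h₁.ne h₂.ne,
      norm_leftArc_sub_mul him₁ hmem, sq_abs, Real.cos_pi_div_two_sub]
    -- Jordan's inequality `2s/π ≤ sin s` is the source of the constant `π/(4c)`.
    have hsin := Real.mul_le_sin hs.1.le hs.2.le
    have hsin' : s ≤ π / 2 * Real.sin s := by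
      have := mul_le_mul_of_nonneg_left hsin (show 0 ≤ π / 2 by positivity)
      field_simp at this ⊢
      linarith
    have hs0 : 0 < Real.sin s := Real.sin_pos_of_pos_of_lt_pi hs.1 (by linarith [hs.2])
    change c ≤ _ at hm
    set d := ‖leftArc l₁ (π / 2 - s) - l₂‖ * ‖leftArc l₁ (π / 2 - s) - conj l₂‖
    have hd : 0 < d := hc.trans_le hm
    calc l₁.im ^ 2 / (2 * l₁.im ^ 2 * Real.sin s * d) * s
        = s / (2 * Real.sin s * d) := by field_simp
      _ ≤ (π / 2 * Real.sin s) / (2 * Real.sin s * c) := by gcongr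
      _ = π / (4 * c) := by field_simp; norm_num
  have := main.comp_sub_left (π / 2)
  simp only [sub_sub_cancel, sub_zero, sub_self] at this
  exact this.symm

theorem im_integral_arc {l₁ l₂ : ℂ} (him₁ : 0 < l₁.im) (him₂ : 0 < l₂.im)
    (hne : l₁ ≠ l₂) (hre : l₁.re ≤ l₂.re) :
    ‖l₁ - conj l₂‖ * (∫ θ in (0 : ℝ)..(π / 2),
      deriv (leftArc l₁) θ / upperMu l₁ l₂ (leftArc l₁ θ)).im = ellipticK (modulus l₁ l₂) := by
  have hpi := Real.pi_pos
  have hD := norm_sub_conj_pos him₁ him₂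
  have hint := intervalIntegrable_arc_integrand him₁ him₂ hne hre
  have h0mem : (0 : ℝ) ∈ Set.Ioo (-(π / 2)) (π / 2) := ⟨by linarith, by linarith⟩
  have hder : ∀ θ ∈ Set.Ico 0 (π / 2), HasDerivAt (fun s => ellipticF (Complex.arg
        ⟨(cutSqrt l₁ (leftArc l₁ s) * conj (cutSqrt l₂ (leftArc l₁ s))).re,
          ‖l₁ - conj l₂‖ * (leftArc l₁ s).im⟩) (modulus l₁ l₂))
      (‖l₁ - conj l₂‖ * (deriv (leftArc l₁) θ / upperMu l₁ l₂ (leftArc l₁ θ)).im) θ := by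
    intro θ hθ
    have h₁ := leftArc_re_lt him₁ (θ := θ) ⟨by linarith [hθ.1], hθ.2⟩
    have h₂ := h₁.trans_le hre
    refine hasDerivAt_ellipticF_modulus him₁ him₂ hne
      (hasDerivAt_leftArc l₁ θ).differentiableAt.hasDerivAt h₁.ne h₂.ne ?_
    rw [Complex.mem_slitPlane_iff]
    rcases hθ.1.eq_or_lt with rfl | h
    · left
      have e : leftArc l₁ 0 = ((l₁.re - l₁.im : ℝ) : ℂ) := by
        rw [leftArc_eq]; apply Complex.ext <;> simp
      obtain ⟨c₁, hc₁, e₁⟩ := cutSqrt_ofReal_neg (l := l₁) (x := l₁.re - l₁.im) (by linarith)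
      obtain ⟨c₂, hc₂, e₂⟩ := cutSqrt_ofReal_neg (l := l₂) (x := l₁.re - l₁.im) (by linarith)
      rw [e, e₁, e₂]
      simpa using mul_pos_of_neg_of_neg hc₁ hc₂
    · right
      rw [leftArc_eq]
      have := Real.sin_pos_of_pos_of_lt_pi h (by linarith [hθ.2])
      simp only
      positivity
  have hint' : IntervalIntegrable (fun θ => ‖l₁ - conj l₂‖ *
      (deriv (leftArc l₁) θ / upperMu l₁ l₂ (leftArc l₁ θ)).im) volume 0 (π / 2) :=
    (IntervalIntegrable.const_mul ⟨hint.1.im, hint.2.im⟩ _)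
  have lim0 : Filter.Tendsto (fun s => ellipticF (Complex.arg
        ⟨(cutSqrt l₁ (leftArc l₁ s) * conj (cutSqrt l₂ (leftArc l₁ s))).re,
          ‖l₁ - conj l₂‖ * (leftArc l₁ s).im⟩) (modulus l₁ l₂)) (nhdsWithin 0 (Set.Ioi 0))
      (nhds 0) := by
    have := (hder 0 ⟨le_rfl, by positivity⟩).continuousAt.tendsto.mono_left
      (nhdsWithin_le_nhds (s := Set.Ioi 0))
    have e : leftArc l₁ 0 = ((l₁.re - l₁.im : ℝ) : ℂ) := by
      rw [leftArc_eq]; apply Complex.ext <;> simp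
    obtain ⟨c₁, hc₁, e₁⟩ := cutSqrt_ofReal_neg (l := l₁) (x := l₁.re - l₁.im) (by linarith)
    obtain ⟨c₂, hc₂, e₂⟩ := cutSqrt_ofReal_neg (l := l₂) (x := l₁.re - l₁.im) (by linarith)
    have e' : (⟨(cutSqrt l₁ (leftArc l₁ 0) * conj (cutSqrt l₂ (leftArc l₁ 0))).re,
        ‖l₁ - conj l₂‖ * (leftArc l₁ 0).im⟩ : ℂ) = ((c₁ * c₂ : ℝ) : ℂ) := by
      rw [e, e₁, e₂]; apply Complex.ext <;> simp
    rw [e', Complex.arg_ofReal_of_nonneg (mul_pos_of_neg_of_neg hc₁ hc₂).le, ellipticF_zero] at this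
    exact this
  have lim1 : Filter.Tendsto (fun s => ellipticF (Complex.arg
        ⟨(cutSqrt l₁ (leftArc l₁ s) * conj (cutSqrt l₂ (leftArc l₁ s))).re,
          ‖l₁ - conj l₂‖ * (leftArc l₁ s).im⟩) (modulus l₁ l₂)) (nhdsWithin (π / 2) (Set.Iio (π / 2)))
      (nhds (ellipticK (modulus l₁ l₂))) := by
    -- The real part is bounded by `|μ|`, a continuous function of the distances to the four branch
    -- points that vanishes at `l₁`.
    have hre0 : Filter.Tendsto
        (fun s => (cutSqrt l₁ (leftArc l₁ s) * conj (cutSqrt l₂ (leftArc l₁ s))).re)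
        (nhdsWithin (π / 2) (Set.Iio (π / 2))) (nhds 0) := by
      have hc : Continuous fun s => √(‖leftArc l₁ s - l₁‖ * ‖leftArc l₁ s - conj l₁‖ *
          (‖leftArc l₁ s - l₂‖ * ‖leftArc l₁ s - conj l₂‖)) := by
        have := continuous_leftArc l₁
        fun_prop
      have h := (hc.tendsto (π / 2)).mono_left (nhdsWithin_le_nhds (s := Set.Iio (π / 2)))
      have e : leftArc l₁ (π / 2) = l₁ := by rw [leftArc_eq]; apply Complex.ext <;> simp
      rw [e, sub_self, norm_zero, zero_mul, zero_mul, Real.sqrt_zero] at h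
      refine squeeze_zero_norm' ?_ h
      filter_upwards [Ioo_mem_nhdsLT (show (0 : ℝ) < π / 2 by positivity)] with s hs
      have h₁ := leftArc_re_lt him₁ (θ := s) ⟨by linarith [hs.1], hs.2⟩
      have h₂ := h₁.trans_le hre
      rw [← norm_upperMu_sq h₁.ne h₂.ne, Real.sqrt_sq (norm_nonneg _), Real.norm_eq_abs]
      refine (Complex.abs_re_le_norm _).trans_eq ?_
      simp [upperMu]
    have him0 : Filter.Tendsto (fun s => ‖l₁ - conj l₂‖ * (leftArc l₁ s).im)
        (nhdsWithin (π / 2) (Set.Iio (π / 2))) (nhds (‖l₁ - conj l₂‖ * l₁.im)) := by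
      have hc : Continuous fun s => ‖l₁ - conj l₂‖ * (leftArc l₁ s).im := by
        have := continuous_leftArc l₁
        fun_prop
      have h := (hc.tendsto (π / 2)).mono_left (nhdsWithin_le_nhds (s := Set.Iio (π / 2)))
      rw [leftArc_eq, Real.sin_pi_div_two, mul_one] at h
      exact h
    have hy : 0 < ‖l₁ - conj l₂‖ * l₁.im := mul_pos hD him₁
    have harg : Complex.arg ⟨0, ‖l₁ - conj l₂‖ * l₁.im⟩ = π / 2 :=
      Complex.arg_eq_pi_div_two_iff.2 ⟨rfl, hy⟩
    have := (((hasDerivAt_ellipticF (modulus_nonneg l₁ l₂) (modulus_lt_one him₁ him₂ hne)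
      (Complex.arg ⟨0, ‖l₁ - conj l₂‖ * l₁.im⟩)).continuousAt.tendsto.comp
      (Complex.continuousAt_arg (x := ⟨0, ‖l₁ - conj l₂‖ * l₁.im⟩)
        (Complex.mem_slitPlane_iff.2 (Or.inr hy.ne'))).tendsto).comp (tendsto_complex_mk hre0 him0))
    rw [harg] at this
    exact this
  have key := integral_eq_sub_of_hasDerivAt_of_tendsto (by positivity)
    (fun θ hθ => hder θ ⟨hθ.1.le, hθ.2⟩) hint' lim0 lim1
  rw [sub_zero, intervalIntegral.integral_const_mul] at key
  rw [← key]
  congr 1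
  exact (Complex.imCLM.intervalIntegral_comp_comm hint).symm

/-- Conjugation sends the integrand to minus its conjugate, so the two halves of the arc add up to
`2i` times an imaginary part. The lower sheet doubles this, since `μ` and the orientation both
change sign. -/
theorem aPeriod_eq {l₁ l₂ : ℂ} (him₁ : 0 < l₁.im) (him₂ : 0 < l₂.im)
    (hne : l₁ ≠ l₂) (hre : l₁.re ≤ l₂.re) :
    aPeriod l₁ l₂ = 4 * Complex.I * (ellipticK (modulus l₁ l₂) / ‖l₁ - conj l₂‖ : ℝ) := by
  have hpi := Real.pi_pos
  have hint := intervalIntegrable_arc_integrand him₁ him₂ hne hre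
  set g := fun θ => deriv (leftArc l₁) θ / upperMu l₁ l₂ (leftArc l₁ θ) with hg
  have hsymm : ∀ θ ∈ Set.Ioo (-(π / 2)) (π / 2), g (-θ) = -conj (g θ) := by
    intro θ hθ
    have h₁ := leftArc_re_lt him₁ hθ
    have h₂ := h₁.trans_le hre
    simp only [hg, deriv_leftArc_neg, leftArc_neg, upperMu, cutSqrt_conj h₁.ne, cutSqrt_conj h₂.ne,
      map_div₀, map_mul, neg_div]
  have hint2 : IntervalIntegrable (fun θ => g (-θ)) volume 0 (π / 2) := by
    have hc : IntervalIntegrable (fun θ => -conj (g θ)) volume 0 (π / 2) := by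
      rw [intervalIntegrable_iff_integrableOn_Ioo_of_le (by positivity)] at hint ⊢
      exact (Complex.conjCLE.toContinuousLinearMap.integrable_comp hint).neg
    rw [intervalIntegrable_iff_integrableOn_Ioo_of_le (by positivity)] at hc ⊢
    exact hc.congr_fun (fun θ hθ => (hsymm θ ⟨by linarith [hθ.1], hθ.2⟩).symm) measurableSet_Ioo
  have hint3 : IntervalIntegrable g volume (-(π / 2)) 0 := by
    have := (hint2.comp_sub_left 0).symm
    simpa using this
  have hneg : ∫ θ in (-(π / 2))..0, g θ = -conj (∫ θ in (0 : ℝ)..(π / 2), g θ) := by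
    have e := intervalIntegral.integral_comp_neg (a := 0) (b := π / 2) g
    rw [neg_zero] at e
    rw [← e, intervalIntegral.integral_of_le (by positivity),
      intervalIntegral.integral_of_le (by positivity), integral_Ioc_eq_integral_Ioo,
      integral_Ioc_eq_integral_Ioo, ← integral_conj, ← MeasureTheory.integral_neg]
    exact setIntegral_congr_fun measurableSet_Ioo fun θ hθ =>
      hsymm θ ⟨by linarith [hθ.1], hθ.2⟩
  have h2 : ∫ θ in (π / 2)..(-(π / 2)), deriv (leftArc l₁) θ / (-upperMu l₁ l₂ (leftArc l₁ θ)) =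
      ∫ θ in (-(π / 2))..(π / 2), g θ := by
    rw [intervalIntegral.integral_symm, ← intervalIntegral.integral_neg]
    simp only [hg, div_neg, neg_neg]
  have him := im_integral_arc him₁ him₂ hne hre
  have hD := norm_sub_conj_pos him₁ him₂
  rw [aPeriod, h2]
  change (∫ θ in (-(π / 2))..(π / 2), g θ) + _ = _
  rw [← intervalIntegral.integral_add_adjacent_intervals hint3 hint, hneg, ← him]
  change _ = 4 * Complex.I * ((‖l₁ - conj l₂‖ * (∫ θ in (0 : ℝ)..(π / 2), g θ).im /
    ‖l₁ - conj l₂‖ : ℝ) : ℂ)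
  rw [mul_div_cancel_left₀ _ hD.ne']
  apply Complex.ext <;> simp <;> ring

/-! ### The integral along the ray -/

/-- `‖l₁ - l₂‖` times the Jacobi `cn` of the sum of the point `conj l₂ + t` of the curve and its
conjugate. -/
noncomputable def rayCn (l₁ l₂ : ℂ) (t : ℝ) : ℝ :=
  (‖conj l₂ + t - conj l₁‖ * ‖conj l₂ + t - l₂‖ - ‖conj l₂ + t - l₁‖ * t) / (2 * l₂.im)

/-- `‖l₁ - l₂‖` times the Jacobi `sn` of the sum of the point `conj l₂ + t` of the curve and its
conjugate. -/
noncomputable def raySn (l₁ l₂ : ℂ) (t : ℝ) : ℝ :=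
  (cutSqrt l₁ (conj l₂ + t) * conj (cutSqrt l₂ (conj l₂ + t))).im / l₂.im

theorem hasDerivAt_norm_ray_sub {l w : ℂ} {t : ℝ} (h : conj l + t - w ≠ 0) :
    HasDerivAt (fun t : ℝ => ‖conj l + t - w‖)
      ((l.re + t - w.re) / ‖conj l + t - w‖) t := by
  have e : ∀ s : ℝ, ‖conj l + s - w‖ = √((l.re + s - w.re) ^ 2 + (-l.im - w.im) ^ 2) := by
    intro s
    rw [← Real.sqrt_sq (norm_nonneg (conj l + s - w)), norm_sub_sq_eq]
    simp
  have hne : (l.re + t - w.re) ^ 2 + (-l.im - w.im) ^ 2 ≠ 0 := by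
    intro h0
    apply h
    rw [← norm_eq_zero, e, h0, Real.sqrt_zero]
  have hd : HasDerivAt (fun s : ℝ => (l.re + s - w.re) ^ 2 + (-l.im - w.im) ^ 2)
      (2 * (l.re + t - w.re)) t := by
    simpa using ((((hasDerivAt_id t).const_add l.re).sub_const w.re).pow 2).add_const
      ((-l.im - w.im) ^ 2)
  have := hd.sqrt hne
  simp only [e]
  refine this.congr_deriv ?_
  rw [mul_div_mul_left _ _ two_ne_zero]

/-- The constant bounds control the integrand as `t → 0`, the bounds by `t` at infinity. `Re l₁ ≤ Re
l₂` ensures that the ray moves away from `conj l₁`. -/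
theorem ray_norm_facts {l₁ l₂ : ℂ} (hre : l₁.re ≤ l₂.re)
    {t : ℝ} (ht : 0 ≤ t) :
    (l₁.im + l₂.im ≤ ‖conj l₂ + t - l₁‖ ∧ t ≤ ‖conj l₂ + t - l₁‖) ∧
    (‖l₁ - l₂‖ ≤ ‖conj l₂ + t - conj l₁‖ ∧ t ≤ ‖conj l₂ + t - conj l₁‖) ∧
    (2 * l₂.im ≤ ‖conj l₂ + t - l₂‖ ∧ t ≤ ‖conj l₂ + t - l₂‖) ∧
    ‖conj l₂ + t - conj l₂‖ = t := by
  have hE := norm_sub_sq_eq l₁ l₂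
  have h₁ := norm_sub_sq_eq (conj l₂ + t) l₁
  have h₂ := norm_sub_sq_eq (conj l₂ + t) (conj l₁)
  have h₃ := norm_sub_sq_eq (conj l₂ + t) l₂
  simp only [Complex.add_re, Complex.add_im, Complex.conj_re, Complex.conj_im, Complex.ofReal_re,
    Complex.ofReal_im] at h₁ h₂ h₃
  have hd : 0 ≤ t * (l₂.re - l₁.re) := mul_nonneg ht (by linarith)
  refine ⟨⟨?_, ?_⟩, ⟨?_, ?_⟩, ⟨?_, ?_⟩, ?_⟩
  · refine le_of_sq_le_sq ?_ (norm_nonneg _)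
    rw [h₁]; nlinarith [sq_nonneg (l₂.re + t - l₁.re)]
  · refine le_of_sq_le_sq ?_ (norm_nonneg _)
    rw [h₁]; nlinarith [sq_nonneg (l₂.re - l₁.re), sq_nonneg (l₁.im + l₂.im)]
  · refine le_of_sq_le_sq ?_ (norm_nonneg _)
    rw [h₂, hE]; nlinarith
  · refine le_of_sq_le_sq ?_ (norm_nonneg _)
    rw [h₂]; nlinarith [sq_nonneg (l₂.re - l₁.re), sq_nonneg (l₁.im - l₂.im)]
  · refine le_of_sq_le_sq ?_ (norm_nonneg _)
    rw [h₃]; nlinarith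
  · refine le_of_sq_le_sq ?_ (norm_nonneg _)
    rw [h₃]; nlinarith
  · simp [abs_of_nonneg ht]

theorem rayCn_sq_add_raySn_sq {l₁ l₂ : ℂ} (him₂ : 0 < l₂.im) (hre : l₁.re ≤ l₂.re)
    {t : ℝ} (ht : 0 < t) :
    rayCn l₁ l₂ t ^ 2 + raySn l₁ l₂ t ^ 2 = ‖l₁ - l₂‖ ^ 2 := by
  have g₁ : (conj l₂ + (t : ℂ)).re ≠ l₁.re := by simp; linarith
  have g₂ : (conj l₂ + (t : ℂ)).re ≠ l₂.re := by simp; linarith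
  have hE := norm_sub_sq_eq l₁ l₂
  have h₁ := norm_sub_sq_eq (conj l₂ + t) l₁
  have h₂ := norm_sub_sq_eq (conj l₂ + t) (conj l₁)
  have h₃ := norm_sub_sq_eq (conj l₂ + t) l₂
  have h₄ : ‖conj l₂ + t - conj l₂‖ = t := by simp [abs_of_pos ht]
  have r₁ := cutSqrt_re_sq_sub g₁
  have r₂ := cutSqrt_re_sq_sub g₂
  have i₁ := cutSqrt_re_mul_im g₁
  have i₂ := cutSqrt_re_mul_im g₂
  have n₁ := norm_cutSqrt_sq g₁
  have n₂ := norm_cutSqrt_sq g₂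
  rw [norm_sq_eq_re_im] at n₁ n₂
  rw [h₄] at n₂
  unfold rayCn raySn
  generalize ‖conj l₂ + t - l₁‖ = P₁ at *
  generalize ‖conj l₂ + t - conj l₁‖ = N₁ at *
  generalize ‖conj l₂ + t - l₂‖ = P₂ at *
  generalize cutSqrt l₁ (conj l₂ + t) = c₁ at *
  generalize cutSqrt l₂ (conj l₂ + t) = c₂ at *
  simp only [Complex.mul_im, Complex.conj_re, Complex.conj_im, Complex.add_re, Complex.add_im,
    Complex.ofReal_re, Complex.ofReal_im] at *
  rw [div_pow, div_pow, hE]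
  -- `2 (Im c₁c̄₂)² = |c₁|²|c₂|² - Re (c₁² c̄₂²)`; the first term cancels the cross term of
  -- `rayCn²`, the second is polynomial in the coordinates.
  have e : 2 * (c₁.re * -c₂.im + c₁.im * c₂.re) ^ 2 =
      (c₁.re ^ 2 + c₁.im ^ 2) * (c₂.re ^ 2 + c₂.im ^ 2) -
      (c₁.re ^ 2 - c₁.im ^ 2) * (c₂.re ^ 2 - c₂.im ^ 2) -
      4 * (c₁.re * c₁.im) * (c₂.re * c₂.im) := by ring
  rw [n₁, n₂, r₁, r₂, i₁, i₂] at e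
  have e' : (N₁ * P₂ - P₁ * t) ^ 2 = N₁ ^ 2 * P₂ ^ 2 + P₁ ^ 2 * t ^ 2 - 2 * (P₁ * N₁ * (P₂ * t)) := by
    ring
  rw [h₁, h₂, h₃] at e'
  field_simp
  linear_combination e' + 2 * e

/-- This is `sn' = cn dn` in the variable `u` with `du = D Re (dλ/μ)`: the factor over `2 * l₂.im`
is `D dn`. -/
theorem hasDerivAt_raySn {l₁ l₂ : ℂ} (him₂ : 0 < l₂.im)
    (hre : l₁.re ≤ l₂.re) {t : ℝ} (ht : 0 < t) :
    HasDerivAt (raySn l₁ l₂)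
      (rayCn l₁ l₂ t * ((‖conj l₂ + t - l₁‖ * ‖conj l₂ + t - l₂‖ - ‖conj l₂ + t - conj l₁‖ * t) /
        (2 * l₂.im)) * (1 / upperMu l₁ l₂ (conj l₂ + t)).re) t := by
  have g₁ : (conj l₂ + (t : ℂ)).re ≠ l₁.re := by simp; linarith
  have g₂ : (conj l₂ + (t : ℂ)).re ≠ l₂.re := by simp; linarith
  have hγ : HasDerivAt (fun t : ℝ => conj l₂ + (t : ℂ)) 1 t :=
    (Complex.ofRealCLM.hasDerivAt (x := t)).const_add _
  have d := (Complex.imCLM.hasFDerivAt.comp_hasDerivAt t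
    (hasDerivAt_cutSqrt_mul_conj hγ g₁ g₂)).div_const l₂.im
  refine HasDerivAt.congr_deriv (f := raySn l₁ l₂) d ?_
  have h₁ := norm_sub_sq_eq (conj l₂ + t) l₁
  have h₂ := norm_sub_sq_eq (conj l₂ + t) (conj l₁)
  have h₃ := norm_sub_sq_eq (conj l₂ + t) l₂
  have h₄ : ‖conj l₂ + t - conj l₂‖ = t := by simp [abs_of_pos ht]
  have r₁ := cutSqrt_re_sq_sub g₁
  have r₂ := cutSqrt_re_sq_sub g₂
  have i₁ := cutSqrt_re_mul_im g₁
  have i₂ := cutSqrt_re_mul_im g₂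
  have n₁ := norm_cutSqrt_sq g₁
  have n₂ := norm_cutSqrt_sq g₂
  have m₁ := norm_sq_eq_re_im (cutSqrt l₁ (conj l₂ + t))
  have m₂ := norm_sq_eq_re_im (cutSqrt l₂ (conj l₂ + t))
  rw [n₁] at m₁
  rw [n₂] at m₂
  have hg : 1 / upperMu l₁ l₂ (conj l₂ + t) *
      (cutSqrt l₁ (conj l₂ + t) * cutSqrt l₂ (conj l₂ + t)) = 1 := by
    rw [upperMu, one_div_mul_cancel]
    exact mul_ne_zero (cutSqrt_ne_zero g₁) (cutSqrt_ne_zero g₂)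
  have hgi := congrArg Complex.im hg
  rw [n₁, n₂]
  rw [h₄] at *
  unfold rayCn
  clear n₁ n₂ d hγ hg g₁ g₂
  generalize 1 / upperMu l₁ l₂ (conj l₂ + t) = g at *
  generalize ‖conj l₂ + t - l₁‖ = P₁ at *
  generalize ‖conj l₂ + t - conj l₁‖ = N₁ at *
  generalize ‖conj l₂ + t - l₂‖ = P₂ at *
  generalize cutSqrt l₁ (conj l₂ + t) = c₁ at *
  generalize cutSqrt l₂ (conj l₂ + t) = c₂ at *
  simp only [Complex.imCLM_apply, Complex.mul_im, Complex.mul_re, Complex.conj_re, Complex.conj_im,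
    Complex.add_re, Complex.add_im, Complex.sub_re, Complex.sub_im,
    Complex.ofReal_re, Complex.ofReal_im, Complex.one_im] at *
  -- The derivative also contains `g.im`; the relation `Im (g c₁c₂) = 0` trades it for `g.re`. Here
  -- `j₁` and `j₂` evaluate `Im (c₁c̄₂)` times the real and imaginary parts of `c₁c₂`.
  have j₁ : (c₁.im * c₂.re - c₁.re * c₂.im) * (c₁.re * c₂.re - c₁.im * c₂.im) =
      -l₂.im * ((l₂.re + t - l₁.re) * (P₂ * t) - t * (P₁ * N₁)) := by
    rw [m₁, m₂]
    linear_combination (c₂.re ^ 2 + c₂.im ^ 2) * i₁ - (c₁.re ^ 2 + c₁.im ^ 2) * i₂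
  have j₂ : 2 * ((c₁.im * c₂.re - c₁.re * c₂.im) * (c₁.re * c₂.im + c₁.im * c₂.re)) =
      P₁ * N₁ * t ^ 2 -
        P₂ * t * ((l₂.re + t - l₁.re) ^ 2 - l₂.im ^ 2 + l₁.im ^ 2) := by
    rw [m₁, m₂]
    linear_combination (c₁.re ^ 2 + c₁.im ^ 2) * r₂ - (c₂.re ^ 2 + c₂.im ^ 2) * r₁
  have j₃ : (N₁ * P₂ - P₁ * t) * (P₁ * P₂ - N₁ * t) =
      2 * (P₁ * N₁ * (t ^ 2 + 2 * l₂.im ^ 2) -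
        P₂ * t * ((l₂.re + t - l₁.re) ^ 2 + l₂.im ^ 2 + l₁.im ^ 2)) := by
    linear_combination P₁ * N₁ * h₃ - P₂ * t * h₂ - P₂ * t * h₁
  field_simp
  linear_combination 4 * g.im * j₁ -
    4 * (c₁.im * c₂.re - c₁.re * c₂.im) * hgi + 2 * g.re * j₂ - g.re * j₃

/-- This is `cn' = -sn dn`. Differentiating the circle identity would give it only where `rayCn` is
nonzero, hence the direct computation. -/
theorem hasDerivAt_rayCn {l₁ l₂ : ℂ} (him₂ : 0 < l₂.im)
    (hre : l₁.re ≤ l₂.re) {t : ℝ} (ht : 0 < t) :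
    HasDerivAt (rayCn l₁ l₂)
      (-(raySn l₁ l₂ t * ((‖conj l₂ + t - l₁‖ * ‖conj l₂ + t - l₂‖ - ‖conj l₂ + t - conj l₁‖ * t) /
        (2 * l₂.im)) * (1 / upperMu l₁ l₂ (conj l₂ + t)).re)) t := by
  obtain ⟨⟨-, q₁⟩, ⟨-, q₂⟩, ⟨-, q₃⟩, h₄⟩ := ray_norm_facts hre ht.le
  have q₁ := ht.trans_le q₁
  have q₂ := ht.trans_le q₂
  have q₃ := ht.trans_le q₃
  have g₁ : (conj l₂ + (t : ℂ)).re ≠ l₁.re := by simp; linarith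
  have g₂ : (conj l₂ + (t : ℂ)).re ≠ l₂.re := by simp; linarith
  have d := (((hasDerivAt_norm_ray_sub (norm_pos_iff.1 q₂)).mul
    (hasDerivAt_norm_ray_sub (norm_pos_iff.1 q₃))).sub
    ((hasDerivAt_norm_ray_sub (norm_pos_iff.1 q₁)).mul (hasDerivAt_id t))).div_const (2 * l₂.im)
  refine HasDerivAt.congr_deriv (f := rayCn l₁ l₂) d ?_
  have i₁ := cutSqrt_re_mul_im g₁
  have i₂ := cutSqrt_re_mul_im g₂
  have n₁ := norm_cutSqrt_sq g₁
  have n₂ := norm_cutSqrt_sq g₂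
  rw [norm_sq_eq_re_im] at n₁ n₂
  rw [h₄] at n₂
  have hg : 1 / upperMu l₁ l₂ (conj l₂ + t) *
      (cutSqrt l₁ (conj l₂ + t) * cutSqrt l₂ (conj l₂ + t)) = 1 := by
    rw [upperMu, one_div_mul_cancel]
    exact mul_ne_zero (cutSqrt_ne_zero g₁) (cutSqrt_ne_zero g₂)
  have hgi := congrArg Complex.im hg
  have hgr := congrArg Complex.re hg
  unfold raySn
  clear d hg g₁ g₂ h₄
  generalize 1 / upperMu l₁ l₂ (conj l₂ + t) = g at *
  generalize ‖conj l₂ + t - l₁‖ = P₁ at *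
  generalize ‖conj l₂ + t - conj l₁‖ = N₁ at *
  generalize ‖conj l₂ + t - l₂‖ = P₂ at *
  generalize cutSqrt l₁ (conj l₂ + t) = c₁ at *
  generalize cutSqrt l₂ (conj l₂ + t) = c₂ at *
  simp only [id, Complex.mul_im, Complex.mul_re, Complex.conj_re, Complex.conj_im,
    Complex.add_re, Complex.add_im, Complex.one_re,
    Complex.ofReal_re, Complex.ofReal_im, Complex.one_im] at *
  have hgm : g.re * (P₁ * N₁ * (P₂ * t)) = c₁.re * c₂.re - c₁.im * c₂.im := by
    rw [← n₁, ← n₂]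
    linear_combination (c₁.re * c₂.re - c₁.im * c₂.im) * hgr +
      (c₁.re * c₂.im + c₁.im * c₂.re) * hgi
  have hgm' : g.re = (c₁.re * c₂.re - c₁.im * c₂.im) / (P₁ * N₁ * (P₂ * t)) := by
    rw [eq_div_iff (by positivity), hgm]
  have j₁ : (c₁.re * -c₂.im + c₁.im * c₂.re) * (c₁.re * c₂.re - c₁.im * c₂.im) =
      -l₂.im * ((l₂.re + t - l₁.re) * (P₂ * t) - t * (P₁ * N₁)) := by
    rw [← n₁, ← n₂]
    linear_combination (c₂.re ^ 2 + c₂.im ^ 2) * i₁ - (c₁.re ^ 2 + c₁.im ^ 2) * i₂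
  have j₂ : ∀ V : ℝ, (c₁.re * -c₂.im + c₁.im * c₂.re) / l₂.im * V * g.re =
      -((l₂.re + t - l₁.re) * (P₂ * t) - t * (P₁ * N₁)) * V / (P₁ * N₁ * (P₂ * t)) := by
    intro V
    rw [hgm']
    field_simp
    linear_combination V * j₁
  rw [j₂]
  field_simp
  ring

/-- Keeps the circle point off the negative real axis, so the principal argument never jumps by
`2π`. A zero of `raySn` forces `P₁N₁ = xP₂` with `x = Re l₂ + t - Re l₁`, and `xt < N₁²` then gives
`P₁t < N₁P₂`. -/
theorem rayCn_pos_of_raySn_eq_zero {l₁ l₂ : ℂ} (him₂ : 0 < l₂.im)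
    (hne : l₁ ≠ l₂) (hre : l₁.re ≤ l₂.re) {t : ℝ} (ht : 0 < t) (h : raySn l₁ l₂ t = 0) :
    0 < rayCn l₁ l₂ t := by
  obtain ⟨⟨-, q₁⟩, ⟨-, q₂⟩, ⟨-, q₃⟩, h₄⟩ := ray_norm_facts hre ht.le
  have q₁ := ht.trans_le q₁
  have q₂ := ht.trans_le q₂
  have q₃ := ht.trans_le q₃
  have g₁ : (conj l₂ + (t : ℂ)).re ≠ l₁.re := by simp; linarith
  have g₂ : (conj l₂ + (t : ℂ)).re ≠ l₂.re := by simp; linarith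
  have h₂ := norm_sub_sq_eq (conj l₂ + t) (conj l₁)
  have hE : 0 < ‖l₁ - l₂‖ ^ 2 := by
    have : 0 < ‖l₁ - l₂‖ := norm_pos_iff.2 (sub_ne_zero.2 hne)
    positivity
  rw [norm_sub_sq_eq] at hE
  have i₁ := cutSqrt_re_mul_im g₁
  have i₂ := cutSqrt_re_mul_im g₂
  have n₁ := norm_cutSqrt_sq g₁
  have n₂ := norm_cutSqrt_sq g₂
  rw [norm_sq_eq_re_im] at n₁ n₂
  rw [h₄] at n₂
  have h := (div_eq_zero_iff.1 h).resolve_right him₂.ne'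
  unfold rayCn
  clear g₁ g₂ h₄
  generalize ‖conj l₂ + t - l₁‖ = P₁ at *
  generalize ‖conj l₂ + t - conj l₁‖ = N₁ at *
  generalize ‖conj l₂ + t - l₂‖ = P₂ at *
  generalize cutSqrt l₁ (conj l₂ + t) = c₁ at *
  generalize cutSqrt l₂ (conj l₂ + t) = c₂ at *
  simp only [Complex.mul_im, Complex.conj_re, Complex.conj_im,
    Complex.add_re, Complex.add_im,
    Complex.ofReal_re, Complex.ofReal_im] at *
  have j₁ : (c₁.re * -c₂.im + c₁.im * c₂.re) * (c₁.re * c₂.re - c₁.im * c₂.im) =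
      -l₂.im * ((l₂.re + t - l₁.re) * (P₂ * t) - t * (P₁ * N₁)) := by
    rw [← n₁, ← n₂]
    linear_combination (c₂.re ^ 2 + c₂.im ^ 2) * i₁ - (c₁.re ^ 2 + c₁.im ^ 2) * i₂
  rw [h, zero_mul, eq_comm, mul_eq_zero] at j₁
  have j₂ := j₁.resolve_left (by linarith)
  have j₃ : P₁ * N₁ = (l₂.re + t - l₁.re) * P₂ := by
    refine mul_left_cancel₀ ht.ne' ?_
    linear_combination -j₂
  have hx : 0 < l₂.re + t - l₁.re := by linarith
  have hN : (l₂.re + t - l₁.re) * t < N₁ ^ 2 := by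
    rw [h₂]
    rcases hre.eq_or_lt with e | e
    · rw [e, sub_self] at hE
      rw [e]
      nlinarith
    · nlinarith [sq_nonneg (-l₂.im + 0 - -l₁.im)]
  refine div_pos (sub_pos.2 ?_) (by positivity)
  refine lt_of_mul_lt_mul_left (a := l₂.re + t - l₁.re) ?_ hx.le
  calc (l₂.re + t - l₁.re) * (P₁ * t) = P₁ * ((l₂.re + t - l₁.re) * t) := by ring
    _ < P₁ * N₁ ^ 2 := by gcongr
    _ = (l₂.re + t - l₁.re) * (N₁ * P₂) := by linear_combination N₁ * j₃

theorem hasDerivAt_ellipticF_modulus' {l₁ l₂ : ℂ} (him₁ : 0 < l₁.im) (him₂ : 0 < l₂.im)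
    (hne : l₁ ≠ l₂) (hre : l₁.re ≤ l₂.re) {t : ℝ} (ht : 0 < t) :
    HasDerivAt (fun t => ellipticF (Complex.arg ⟨rayCn l₁ l₂ t, raySn l₁ l₂ t⟩) (modulus' l₁ l₂))
      (‖l₁ - conj l₂‖ * (1 / upperMu l₁ l₂ (conj l₂ + t)).re) t := by
  have hslit : (⟨rayCn l₁ l₂ t, raySn l₁ l₂ t⟩ : ℂ) ∈ Complex.slitPlane := by
    rw [Complex.mem_slitPlane_iff]
    by_cases h : raySn l₁ l₂ t = 0
    · exact Or.inl (rayCn_pos_of_raySn_eq_zero him₂ hne hre ht h)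
    · exact Or.inr h
  refine (hasDerivAt_ellipticF_arg (modulus'_nonneg l₁ l₂) (modulus'_lt_one him₁ him₂)
    (hasDerivAt_rayCn him₂ hre ht) (hasDerivAt_raySn him₂ hre ht) hslit).congr_deriv ?_
  have hD0 := norm_sub_conj_pos him₁ him₂
  have hE0 : 0 < ‖l₁ - l₂‖ := norm_pos_iff.2 (sub_ne_zero.2 hne)
  have hsum := rayCn_sq_add_raySn_sq him₂ hre ht
  obtain ⟨⟨-, q₁⟩, ⟨-, q₂⟩, ⟨-, q₃⟩, h₄⟩ := ray_norm_facts hre ht.le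
  have q₁ := ht.trans_le q₁
  have q₂ := ht.trans_le q₂
  have q₃ := ht.trans_le q₃
  set V := (‖conj l₂ + t - l₁‖ * ‖conj l₂ + t - l₂‖ - ‖conj l₂ + t - conj l₁‖ * t) /
    (2 * l₂.im) with hV
  have h₁ := norm_sub_sq_eq (conj l₂ + t) l₁
  have h₂ := norm_sub_sq_eq (conj l₂ + t) (conj l₁)
  have h₃ := norm_sub_sq_eq (conj l₂ + t) l₂
  simp only [Complex.add_re, Complex.add_im, Complex.conj_re, Complex.conj_im, Complex.ofReal_re,
    Complex.ofReal_im] at h₁ h₂ h₃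
  have hDE : ‖l₁ - conj l₂‖ ^ 2 = ‖l₁ - l₂‖ ^ 2 + 4 * l₁.im * l₂.im := by
    rw [norm_sub_conj_sq, norm_sub_sq_eq]; ring
  -- With `D² = E² + 4b₁b₂` and the circle identity this reads `V² = D²(1 - p'² sin² φ)`; `hV0`
  -- selects the positive root.
  have hV2 : V ^ 2 = rayCn l₁ l₂ t ^ 2 + 4 * l₁.im * l₂.im := by
    rw [hV, rayCn, div_pow, div_pow]
    field_simp
    linear_combination (‖conj l₂ + t - l₂‖ ^ 2 - t ^ 2) * (h₁ - h₂) +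
      4 * l₁.im * l₂.im * h₃
  have hV0 : 0 < V := by
    refine div_pos (sub_pos.2 ?_) (by positivity)
    have hNP : ‖conj l₂ + t - conj l₁‖ ≤ ‖conj l₂ + t - l₁‖ :=
      le_of_sq_le_sq (by rw [h₁, h₂]; nlinarith) q₁.le
    exact mul_lt_mul' hNP (lt_of_pow_lt_pow_left₀ 2 q₃.le (by rw [h₃]; nlinarith)) ht.le q₁
  have hrad : 1 - modulus' l₁ l₂ ^ 2 *
      (raySn l₁ l₂ t ^ 2 / (rayCn l₁ l₂ t ^ 2 + raySn l₁ l₂ t ^ 2)) = (V / ‖l₁ - conj l₂‖) ^ 2 := by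
    rw [hsum, modulus', div_pow, div_pow, hV2]
    field_simp
    linear_combination hDE - hsum
  rw [hrad, Real.sqrt_sq (by positivity), hsum]
  field_simp
  linear_combination (1 / upperMu l₁ l₂ (conj l₂ + t)).re * hsum

/-! ### Integrability and end behaviour on the ray -/

theorem continuousOn_ray_integrand {l₁ l₂ : ℂ} (hre : l₁.re ≤ l₂.re) :
    ContinuousOn (fun t : ℝ => 1 / upperMu l₁ l₂ (conj l₂ + t)) (Set.Ioi 0) := by
  intro t ht
  have ht : 0 < t := ht
  have g₁ : (conj l₂ + (t : ℂ)).re ≠ l₁.re := by simp; linarith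
  have g₂ : (conj l₂ + (t : ℂ)).re ≠ l₂.re := by simp; linarith
  refine ContinuousAt.continuousWithinAt (ContinuousAt.div continuousAt_const ?_
    (upperMu_ne_zero g₁ g₂))
  exact ContinuousAt.comp (f := fun t : ℝ => conj l₂ + (t : ℂ)) (continuousAt_upperMu g₁ g₂)
    (by fun_prop)

theorem norm_ray_integrand_sq {l₁ l₂ : ℂ} (hre : l₁.re ≤ l₂.re) {t : ℝ} (ht : 0 < t) :
    ‖1 / upperMu l₁ l₂ (conj l₂ + t)‖ ^ 2 = 1 / (‖conj l₂ + t - l₁‖ * ‖conj l₂ + t - conj l₁‖ *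
      (‖conj l₂ + t - l₂‖ * t)) := by
  have g₁ : (conj l₂ + (t : ℂ)).re ≠ l₁.re := by simp; linarith
  have g₂ : (conj l₂ + (t : ℂ)).re ≠ l₂.re := by simp; linarith
  rw [norm_div, div_pow, norm_upperMu_sq g₁ g₂, (ray_norm_facts hre ht.le).2.2.2]
  simp

theorem integrableOn_ray_integrand {l₁ l₂ : ℂ} (him₁ : 0 < l₁.im) (him₂ : 0 < l₂.im)
    (hne : l₁ ≠ l₂) (hre : l₁.re ≤ l₂.re) :
    IntegrableOn (fun t : ℝ => 1 / upperMu l₁ l₂ (conj l₂ + t)) (Set.Ioi 0) := by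
  have hE0 : 0 < ‖l₁ - l₂‖ := norm_pos_iff.2 (sub_ne_zero.2 hne)
  have hcont := continuousOn_ray_integrand hre
  have near : IntegrableOn (fun t : ℝ => 1 / upperMu l₁ l₂ (conj l₂ + t)) (Set.Ioc 0 1) := by
    rw [← intervalIntegrable_iff_integrableOn_Ioc_of_le zero_le_one]
    refine intervalIntegrable_of_norm_sq_mul_le
      (C := 1 / ((l₁.im + l₂.im) * ‖l₁ - l₂‖ * (2 * l₂.im))) zero_le_one
      (hcont.mono Set.Ioo_subset_Ioi_self) fun t ht => ?_
    have ht0 : 0 < t := ht.1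
    obtain ⟨⟨q₁, -⟩, ⟨q₂, -⟩, ⟨q₃, -⟩, -⟩ := ray_norm_facts hre ht0.le
    rw [norm_ray_integrand_sq hre ht0]
    have p₁ : 0 < l₁.im + l₂.im := by linarith
    have p₁' := p₁.trans_le q₁
    have p₂' := hE0.trans_le q₂
    have p₃' := (show 0 < 2 * l₂.im by linarith).trans_le q₃
    calc 1 / (‖conj l₂ + t - l₁‖ * ‖conj l₂ + t - conj l₁‖ * (‖conj l₂ + t - l₂‖ * t)) * t
        = 1 / (‖conj l₂ + t - l₁‖ * ‖conj l₂ + t - conj l₁‖ * ‖conj l₂ + t - l₂‖) := by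
          field_simp
      _ ≤ _ := by gcongr
  have far : IntegrableOn (fun t : ℝ => 1 / upperMu l₁ l₂ (conj l₂ + t)) (Set.Ioi 1) := by
    refine Integrable.mono' (integrableOn_Ioi_rpow_of_lt (a := -2) (by norm_num) zero_lt_one)
      ((hcont.mono (Set.Ioi_subset_Ioi zero_le_one)).aestronglyMeasurable measurableSet_Ioi) ?_
    refine (ae_restrict_iff' measurableSet_Ioi).2 (Filter.Eventually.of_forall fun t ht => ?_)
    have ht0 : 0 < t := zero_lt_one.trans ht
    obtain ⟨⟨-, q₁⟩, ⟨-, q₂⟩, ⟨-, q₃⟩, -⟩ := ray_norm_facts hre ht0.le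
    refine le_of_sq_le_sq ?_ (by positivity)
    rw [norm_ray_integrand_sq hre ht0, Real.rpow_neg ht0.le, Real.rpow_two, inv_pow, ← one_div]
    calc _ ≤ 1 / (t * t * (t * t)) := by gcongr
      _ = 1 / (t ^ 2) ^ 2 := by ring
  rw [← Set.Ioc_union_Ioi_eq_Ioi zero_le_one]
  exact near.union far

theorem tendsto_rayCn_zero {l₁ l₂ : ℂ} (him₂ : 0 < l₂.im) :
    Filter.Tendsto (rayCn l₁ l₂) (nhdsWithin 0 (Set.Ioi 0)) (nhds ‖l₁ - l₂‖) := by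
  have hc : Continuous (rayCn l₁ l₂) := by
    unfold rayCn
    fun_prop
  have h := (hc.tendsto 0).mono_left (nhdsWithin_le_nhds (s := Set.Ioi 0))
  have e₁ : ‖conj l₂ - conj l₁‖ = ‖l₁ - l₂‖ := by
    rw [← map_sub, Complex.norm_conj, norm_sub_rev]
  have e₂ : ‖conj l₂ - l₂‖ = 2 * l₂.im := by
    refine (pow_left_inj₀ (norm_nonneg _) (by positivity) two_ne_zero).1 ?_
    rw [norm_sub_sq_eq]
    simp; ring
  have e : rayCn l₁ l₂ 0 = ‖l₁ - l₂‖ := by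
    rw [rayCn, Complex.ofReal_zero, add_zero, e₁, e₂]
    field_simp
    ring
  rwa [e] at h

theorem tendsto_norm_ray_sub_div (l w : ℂ) :
    Filter.Tendsto (fun t : ℝ => ‖conj l + t - w‖ / t) Filter.atTop (nhds 1) := by
  have h : Filter.Tendsto (fun t : ℝ => ‖1 + (conj l - w) * ((t⁻¹ : ℝ) : ℂ)‖) Filter.atTop
      (nhds ‖1 + (conj l - w) * ((0 : ℝ) : ℂ)‖) := by
    have hc : Continuous fun s : ℝ => ‖1 + (conj l - w) * (s : ℂ)‖ := by fun_prop
    exact (hc.tendsto 0).comp tendsto_inv_atTop_zero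
  rw [Complex.ofReal_zero, mul_zero, add_zero, norm_one] at h
  refine h.congr' ?_
  filter_upwards [Filter.eventually_gt_atTop 0] with t ht
  have ht' : (t : ℂ) ≠ 0 := by exact_mod_cast ht.ne'
  have e : ‖(t : ℂ)‖ = t := by simp [abs_of_pos ht]
  have e' : ‖conj l + t - w‖ / t = ‖(conj l + t - w) / (t : ℂ)‖ := by rw [norm_div, e]
  rw [e']
  congr 1
  push_cast
  field_simp
  ring

theorem tendsto_rayCn_atTop {l₁ l₂ : ℂ} (him₂ : 0 < l₂.im) (hre : l₁.re ≤ l₂.re) :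
    Filter.Tendsto (rayCn l₁ l₂) Filter.atTop (nhds (l₂.im - l₁.im)) := by
  have T₁ := tendsto_norm_ray_sub_div l₂ l₁
  have T₂ := tendsto_norm_ray_sub_div l₂ (conj l₁)
  have T₃ := tendsto_norm_ray_sub_div l₂ l₂
  -- `rayCn` is a difference of terms of order `t²`, so it is multiplied by `N₁P₂ + P₁t`. This is
  -- the resulting numerator `N₁²P₂² - P₁²t² = -4b₁b₂t² + 4b₂²N₁²`, divided by `t²`.
  have hnum : Filter.Tendsto (fun t : ℝ => -4 * l₁.im * l₂.im + 4 * l₂.im ^ 2 *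
      ((1 + (l₂.re - l₁.re) * t⁻¹) ^ 2 + ((l₁.im - l₂.im) * t⁻¹) ^ 2)) Filter.atTop
      (nhds (-4 * l₁.im * l₂.im + 4 * l₂.im ^ 2 *
      ((1 + (l₂.re - l₁.re) * 0) ^ 2 + ((l₁.im - l₂.im) * 0) ^ 2))) := by
    have hc : Continuous fun s : ℝ => -4 * l₁.im * l₂.im + 4 * l₂.im ^ 2 *
      ((1 + (l₂.re - l₁.re) * s) ^ 2 + ((l₁.im - l₂.im) * s) ^ 2) := by fun_prop
    exact (hc.tendsto 0).comp tendsto_inv_atTop_zero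
  have h := hnum.div (((T₂.mul T₃).add T₁).const_mul (2 * l₂.im)) (by positivity)
  have e : (-4 * l₁.im * l₂.im + 4 * l₂.im ^ 2 *
      ((1 + (l₂.re - l₁.re) * 0) ^ 2 + ((l₁.im - l₂.im) * 0) ^ 2)) /
      (2 * l₂.im * (1 * 1 + 1)) = l₂.im - l₁.im := by
    field_simp
    ring
  rw [e] at h
  refine h.congr' ?_
  filter_upwards [Filter.eventually_gt_atTop 0] with t ht
  obtain ⟨⟨-, q₁⟩, ⟨-, q₂⟩, ⟨-, q₃⟩, -⟩ := ray_norm_facts hre ht.le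
  have q₁ := ht.trans_le q₁
  have q₂ := ht.trans_le q₂
  have q₃ := ht.trans_le q₃
  have h₁ := norm_sub_sq_eq (conj l₂ + t) l₁
  have h₂ := norm_sub_sq_eq (conj l₂ + t) (conj l₁)
  have h₃ := norm_sub_sq_eq (conj l₂ + t) l₂
  simp only [Complex.add_re, Complex.add_im, Complex.conj_re, Complex.conj_im, Complex.ofReal_re,
    Complex.ofReal_im] at h₁ h₂ h₃
  simp only [Pi.div_apply, rayCn]
  generalize ‖conj l₂ + t - l₁‖ = P₁ at *
  generalize ‖conj l₂ + t - conj l₁‖ = N₁ at *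
  generalize ‖conj l₂ + t - l₂‖ = P₂ at *
  rw [div_eq_div_iff (by positivity) (by positivity)]
  field_simp
  linear_combination t ^ 2 * h₁ - P₂ ^ 2 * h₂ -
    ((l₂.re + t - l₁.re) ^ 2 + (-l₂.im + 0 - -l₁.im) ^ 2) * h₃

/-- The value of `cn` at the real part of the integral of the holomorphic differential along the
ray. -/
theorem cos_jacobiAm_ray {l₁ l₂ : ℂ} (him₁ : 0 < l₁.im) (him₂ : 0 < l₂.im)
    (hne : l₁ ≠ l₂) (hre : l₁.re ≤ l₂.re) :
    Real.cos (jacobiAm (‖l₁ - conj l₂‖ *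
      (∫ t in Set.Ioi (0 : ℝ), 1 / upperMu l₁ l₂ (conj l₂ + t)).re) (modulus' l₁ l₂)) =
      (l₂.im - l₁.im) / ‖l₁ - l₂‖ := by
  have hE0 : 0 < ‖l₁ - l₂‖ := norm_pos_iff.2 (sub_ne_zero.2 hne)
  have k₀ := modulus'_nonneg l₁ l₂
  have k₁ := modulus'_lt_one him₁ him₂
  have hint := integrableOn_ray_integrand him₁ him₂ hne hre
  have hint' : IntegrableOn (fun t : ℝ => ‖l₁ - conj l₂‖ *
      (1 / upperMu l₁ l₂ (conj l₂ + t)).re) (Set.Ioi 0) := Integrable.const_mul hint.re _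
  set φ : ℝ → ℝ := fun t => Complex.arg ⟨rayCn l₁ l₂ t, raySn l₁ l₂ t⟩ with hφ
  set u := ‖l₁ - conj l₂‖ * (∫ t in Set.Ioi (0 : ℝ), 1 / upperMu l₁ l₂ (conj l₂ + t)).re with hu
  have hu' : ∫ t in Set.Ioi (0 : ℝ), ‖l₁ - conj l₂‖ * (1 / upperMu l₁ l₂ (conj l₂ + t)).re = u := by
    rw [MeasureTheory.integral_const_mul, hu]
    congr 1
    exact Complex.reCLM.integral_comp_comm hint
  have hder := fun t (ht : 0 < t) => hasDerivAt_ellipticF_modulus' him₁ him₂ hne hre ht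
  have lim0 : Filter.Tendsto (fun t => ellipticF (φ t) (modulus' l₁ l₂))
      (nhdsWithin 0 (Set.Ioi 0)) (nhds 0) := by
    have hC := tendsto_rayCn_zero (l₁ := l₁) him₂
    -- The circle identity replaces continuity of `cutSqrt` at the branch point.
    have hS : Filter.Tendsto (raySn l₁ l₂) (nhdsWithin 0 (Set.Ioi 0)) (nhds 0) := by
      have h := ((hC.pow 2).const_sub (‖l₁ - l₂‖ ^ 2)).sqrt
      rw [sub_self, Real.sqrt_zero] at h
      refine squeeze_zero_norm' ?_ h
      filter_upwards [self_mem_nhdsWithin] with t ht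
      rw [← rayCn_sq_add_raySn_sq him₂ hre ht, add_sub_cancel_left, Real.sqrt_sq_eq_abs,
        Real.norm_eq_abs]
    have harg : Complex.arg ⟨‖l₁ - l₂‖, 0⟩ = 0 := Complex.arg_ofReal_of_nonneg hE0.le
    have := ((hasDerivAt_ellipticF k₀ k₁ (Complex.arg ⟨‖l₁ - l₂‖, 0⟩)).continuousAt.tendsto.comp
      (Complex.continuousAt_arg (x := ⟨‖l₁ - l₂‖, 0⟩)
        (Complex.mem_slitPlane_iff.2 (Or.inl hE0))).tendsto).comp (tendsto_complex_mk hC hS)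
    rw [harg, ellipticF_zero] at this
    exact this
  have hF : ∀ t, 0 < t → ∫ s in (0 : ℝ)..t, ‖l₁ - conj l₂‖ *
      (1 / upperMu l₁ l₂ (conj l₂ + s)).re = ellipticF (φ t) (modulus' l₁ l₂) := by
    intro t ht
    have h := integral_eq_sub_of_hasDerivAt_of_tendsto ht (fun s hs => hder s hs.1)
      ((intervalIntegrable_iff_integrableOn_Ioc_of_le ht.le).2
        (hint'.mono_set Set.Ioc_subset_Ioi_self)) lim0
      ((hder t ht).continuousAt.tendsto.mono_left nhdsWithin_le_nhds)
    rw [h, sub_zero]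
  have hlim : Filter.Tendsto (fun t => ellipticF (φ t) (modulus' l₁ l₂)) Filter.atTop (nhds u) := by
    have h := intervalIntegral_tendsto_integral_Ioi 0 hint' Filter.tendsto_id
    rw [hu'] at h
    refine h.congr' ?_
    filter_upwards [Filter.eventually_gt_atTop 0] with t ht
    exact hF t ht
  have hφlim : Filter.Tendsto φ Filter.atTop (nhds (jacobiAm u (modulus' l₁ l₂))) := by
    rw [tendsto_iff_norm_sub_tendsto_zero] at hlim ⊢
    refine squeeze_zero (fun _ => norm_nonneg _) (fun t => ?_) hlim
    have h := abs_sub_le_abs_ellipticF_sub k₀ k₁ (jacobiAm u (modulus' l₁ l₂)) (φ t)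
    rwa [ellipticF_jacobiAm k₀ k₁] at h
  refine tendsto_nhds_unique ((Real.continuous_cos.tendsto _).comp hφlim) ?_
  refine ((tendsto_rayCn_atTop him₂ hre).div_const ‖l₁ - l₂‖).congr' ?_
  filter_upwards [Filter.eventually_gt_atTop 0] with t ht
  have hn : ‖(⟨rayCn l₁ l₂ t, raySn l₁ l₂ t⟩ : ℂ)‖ = ‖l₁ - l₂‖ := by
    refine (pow_left_inj₀ (norm_nonneg _) hE0.le two_ne_zero).1 ?_
    rw [norm_sq_eq_re_im]
    exact rayCn_sq_add_raySn_sq him₂ hre ht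
  have h0 : (⟨rayCn l₁ l₂ t, raySn l₁ l₂ t⟩ : ℂ) ≠ 0 := norm_pos_iff.1 (hn ▸ hE0)
  simp only [Function.comp, hφ]
  rw [Complex.cos_arg h0, hn]

/-! ### Evaluation of dn -/

theorem mainTheorem12 (l₁ l₂ : ℂ) (him₁ : 0 < l₁.im) (him₂ : 0 < l₂.im) (hne : l₁ ≠ l₂)
    (hre : l₁.re ≤ l₂.re) :
    wParam l₁ l₂ ^ 2 = |(l₁ - conj l₂).im| ^ 2 / ‖l₁ - conj l₂‖ ^ 2 := by
  have hpi := Real.pi_pos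
  have hD0 := norm_sub_conj_pos him₁ him₂
  have hE0 : 0 < ‖l₁ - l₂‖ := norm_pos_iff.2 (sub_ne_zero.2 hne)
  have k₀ := modulus'_nonneg l₁ l₂
  have k₁ := modulus'_lt_one him₁ him₂
  have hK := ellipticK_pos (modulus_nonneg l₁ l₂) (modulus_lt_one him₁ him₂ hne)
  have hcos := cos_jacobiAm_ray him₁ him₂ hne hre
  set J := ∫ t in Set.Ioi (0 : ℝ), 1 / upperMu l₁ l₂ (conj l₂ + t) with hJ
  -- Both sheets contribute `J`, so `r = 2J · 2πi / (4iK/D)`.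
  have hr : shiftR l₁ l₂ = ((π * ‖l₁ - conj l₂‖ / ellipticK (modulus l₁ l₂) : ℝ) : ℂ) * J := by
    have hK' : (ellipticK (modulus l₁ l₂) : ℂ) ≠ 0 := by exact_mod_cast hK.ne'
    have hD' : (‖l₁ - conj l₂‖ : ℂ) ≠ 0 := by exact_mod_cast hD0.ne'
    rw [shiftR, aPeriod_eq him₁ him₂ hne hre]
    simp only [one_div_neg_eq_neg_one_div, MeasureTheory.integral_neg, neg_neg]
    rw [← hJ]
    push_cast
    field_simp
    ring
  have harg : 2 * ellipticK (modulus l₁ l₂) * rhoParam l₁ l₂ / π = ‖l₁ - conj l₂‖ * J.re := by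
    rw [rhoParam, hr, Complex.re_ofReal_mul]
    field_simp
  -- Only `sin²` of the amplitude enters, so its cosine suffices and the sign of `sn` is irrelevant.
  rw [wParam, harg, jacobiDn, Real.sq_sqrt (ellipticF_radicand_pos k₀ k₁ _).le, Real.sin_sq, hcos,
    modulus', sq_abs]
  have hD2 := norm_sub_conj_sq l₁ l₂
  have hE2 := norm_sub_sq_eq l₁ l₂
  simp only [Complex.sub_im, Complex.conj_im]
  field_simp
  rw [hD2, hE2]
  ring
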